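/- **Setting.** Let $Y$ be a subset of $\mathbb P=\mathbb P^N(\mathbb C)$ with the subspace topology (for example the image of a projective variety, possibly singular, under a closed embedding) and let $j:Y\hookrightarrow\mathbb P$ be the inclusion. Let $\mathcal A_{\mathbb P}$ be the sheaf of complex valued $C^\infty$ functions on $\mathbb P$ and $\mathcal O(1)$ the $\mathcal A_{\mathbb P}$-module of $C^\infty$ sections of the hyperplane bundle. Put $\mathcal R=j^{-1}\mathcal A_{\mathbb P}$; let $\mathcal A_Y$ be the sheaf of those functions on $Y$ which are locally restrictions of $C^\infty$ functions on open sets of $\mathbb P$, let $\pi:\mathcal R\to\mathcal A_Y$ be the restriction epimorphism, and let $\mathsf L=\mathcal A_Y\otimes_{\mathcal R}j^{-1}\mathcal O(1)$. For a sheaf of $\mathbb C$-algebras $\mathcal A$ let $\mathcal A^1$ be the sheaf associated with $U\mapsto\Omega_{\mathcal A(U)/\mathbb C}$ (Kähler differentials); for $\mathcal A=\mathcal A_{\mathbb P},\mathcal R,\mathcal A_Y$ it is denoted by $\mathcal A^1_{\mathbb P},\mathcal A^1_{\mathcal R},\mathcal A^1_Y$. Let $q:\mathcal A_Y\otimes_{\mathcal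 R}\mathcal A^1_{\mathcal R}\to\mathcal A^1_Y$, $c\otimes db\mapsto c\,d(\pi b)$, be the conormal map. A connection on an $\mathcal A$-module $\mathcal M$ is a morphism $\nabla:\mathcal M\to\mathcal A^1\otimes_{\mathcal A}\mathcal M$ of sheaves of $\mathbb C$-vector spaces with $\nabla(gs)=dg\otimes s+g\nabla s$. A frame of $\mathsf L$ over an open set $U\subset Y$ is a section $\sigma\in\mathsf L(U)$ for which $g\mapsto g\sigma$ is an isomorphism $\mathcal A_Y|_U\to\mathsf L|_U$. Let $\tilde\nabla:\mathcal O(1)\to\mathcal A^1_{\mathbb P}\otimes\mathcal O(1)$ be a connection on $\mathcal O(1)$ (thus one whose local connection forms are Kähler differentials). Let $U\subset Y$ be open and let $\tilde\sigma\in (j^{-1}\mathcal O(1))(U)$ be such that $\sigma=1\otimes\tilde\sigma$ is a frame of $\mathsf L$ over $U$. We say that $j^{-1}(\tilde\alpha)\in\mathcal A^1_{\mathcal R}(U)$ is the connection form of $\tilde\nabla$ in $\tilde\sigma$ if, near every point of $U$, $\tilde\sigma$ and $j^{-1}(\tilde\alpha)$ are induced by sections $\tilde\sigma_W\in\mathcal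 O(1)(W)$ and $\tilde\alpha_W\in\mathcal A^1_{\mathbb P}(W)$ over an open set $W\subset\mathbb P$ with $\tilde\nabla\tilde\sigma_W=\tilde\alpha_W\otimes\tilde\sigma_W$. Put $\alpha_U:=q_U(1\otimes j^{-1}(\tilde\alpha))\in\mathcal A^1_Y(U)$. **Proposition.** 1. For all such $U$ and $\tilde\sigma$, the connection form $j^{-1}(\tilde\alpha)\in\mathcal A^1_{\mathcal R}(U)$ exists and is unique; so $\alpha_U$ is well defined by $\tilde\nabla$ and $\tilde\sigma$. 2. (Gauge transformation rule.) If $\tilde\sigma,\tilde\sigma'\in(j^{-1}\mathcal O(1))(U)$ both induce frames $\sigma,\sigma'$ of $\mathsf L$ over $U$, and $\alpha_U,\alpha'_U$ are the corresponding forms, then there is exactly one invertible $b\in\mathcal A_Y(U)$ with $\sigma=b\sigma'$, and $$\alpha_U=\alpha'_U+b^{-1}db .$$ 3. Let $\{U_i\}$ be an open covering of $Y$ and, for each $i$, let $\tilde\sigma_i\in(j^{-1}\mathcal O(1))(U_i)$ induce a frame $\sigma_i=1\otimes\tilde\sigma_i$ of $\mathsf L$ over $U_i$, with corresponding form $\alpha_{U_i}$.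 Then the family $\{\alpha_{U_i}\}$ defines a connection on $\mathsf L$: there is exactly one connection $\nabla:\mathsf L\to\mathcal A^1_Y\otimes_{\mathcal A_Y}\mathsf L$ with $\nabla\sigma_i=\alpha_{U_i}\otimes\sigma_i$ for all $i$. -/

import Mathlib

open Filter Topology TopologicalSpace
open scoped TensorProduct KaehlerDifferential LinearAlgebra.Projectivization Manifold ContDiff

noncomputable section

/-!
Sheaves are presented by their étalé spaces: a sheaf is given by its stalks, and a section over
an open set `U` is a family of germs indexed by the points of `U`, subject to a local condition.
-/

namespace GermSheaf

/-- Restriction of a family of germs to a smaller open set. -/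
def restr {X : Type} [TopologicalSpace X] {F : X → Type} {U V : Opens X} (h : V ≤ U)
    (s : ∀ x : U, F x) : ∀ x : V, F x :=
  fun x => s ⟨x.1, h x.2⟩

/-- A sheaf of commutative `ℂ`-algebras on `X`. -/
structure AlgSheaf (X : Type) [TopologicalSpace X] where
  Stalk : X → Type
  [commRing : ∀ x, CommRing (Stalk x)]
  [algebra : ∀ x, Algebra ℂ (Stalk x)]
  sec : ∀ U : Opens X, Subalgebra ℂ (∀ x : U, Stalk x)
  restr_mem : ∀ {U V : Opens X} (h : V ≤ U) (s : ∀ x : U, Stalk x),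
    s ∈ sec U → restr h s ∈ sec V
  glue_mem : ∀ (U : Opens X) (s : ∀ x : U, Stalk x),
    (∀ x : U, ∃ (V : Opens X) (h : V ≤ U), x.1 ∈ V ∧ restr h s ∈ sec V) → s ∈ sec U

attribute [instance] AlgSheaf.commRing AlgSheaf.algebra

/-- A sheaf of modules over a sheaf of `ℂ`-algebras. -/
structure ModSheaf {X : Type} [TopologicalSpace X] (A : AlgSheaf X) where
  Stalk : X → Type
  [addCommGroup : ∀ x, AddCommGroup (Stalk x)]
  [module : ∀ x, Module (A.Stalk x) (Stalk x)]
  sec : ∀ U : Opens X, Submodule (A.sec U) (∀ x : U, Stalk x)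
  restr_mem : ∀ {U V : Opens X} (h : V ≤ U) (s : ∀ x : U, Stalk x),
    s ∈ sec U → restr h s ∈ sec V
  glue_mem : ∀ (U : Opens X) (s : ∀ x : U, Stalk x),
    (∀ x : U, ∃ (V : Opens X) (h : V ≤ U), x.1 ∈ V ∧ restr h s ∈ sec V) → s ∈ sec U

attribute [instance] ModSheaf.addCommGroup ModSheaf.module

variable {X Y : Type} [TopologicalSpace X] [TopologicalSpace Y]

instance (A : AlgSheaf X) (U : Opens X) : CommRing (A.sec U) := inferInstance

instance {A : AlgSheaf X} (M : ModSheaf A) (U : Opens X) : AddCommGroup (M.sec U) :=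
  Submodule.addCommGroup _

instance {A : AlgSheaf X} (M : ModSheaf A) (U : Opens X) : Module (A.sec U) (M.sec U) :=
  Submodule.module _

instance {A : AlgSheaf X} (M : ModSheaf A) (U : Opens X) : SMul (A.sec U) (M.sec U) :=
  Module.toDistribMulAction.toMulAction.toSMul

/-- The restriction maps of a sheaf of algebras. -/
def AlgSheaf.res (A : AlgSheaf X) {U V : Opens X} (h : V ≤ U) (s : A.sec U) : A.sec V :=
  ⟨restr h s.1, A.restr_mem h s.1 s.2⟩

/-- The restriction maps of a sheaf of modules. -/
def ModSheaf.res {A : AlgSheaf X} (M : ModSheaf A) {U V : Opens X} (h : V ≤ U) (s : M.sec U) :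
    M.sec V :=
  ⟨restr h s.1, M.restr_mem h s.1 s.2⟩

theorem ModSheaf.mem_of_eq {A : AlgSheaf X} (M : ModSheaf A) {U : Opens X}
    {s t : ∀ x : U, M.Stalk x} (h : s = t) (ht : t ∈ M.sec U) : s ∈ M.sec U :=
  h ▸ ht

theorem restr_mem_span {A : AlgSheaf X} {F : X → Type} [∀ x, AddCommGroup (F x)]
    [∀ x, Module (A.Stalk x) (F x)] (G : ∀ U : Opens X, Set (∀ x : U, F x))
    (hG : ∀ {U V : Opens X} (h : V ≤ U), ∀ s ∈ G U, restr h s ∈ G V)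
    {U V : Opens X} (h : V ≤ U) (s : ∀ x : U, F x) (hs : s ∈ Submodule.span (A.sec U) (G U)) :
    restr h s ∈ Submodule.span (A.sec V) (G V) := by
  induction hs using Submodule.span_induction with
  | mem s hs => exact Submodule.subset_span (hG h s hs)
  | zero => exact Submodule.zero_mem _
  | add s t _ _ hs ht => exact Submodule.add_mem _ hs ht
  | smul a s _ hs => exact Submodule.smul_mem _ (A.res h a) hs

/-- The sheaf of modules whose sections are locally finite sums `∑ aᵢ gᵢ` with `aᵢ ∈ A(V)` and
`gᵢ ∈ G(V)`; that is, the sheaf generated by the presheaf of submodules spanned by the `G(V)`. -/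
def ModSheaf.generate (A : AlgSheaf X) (F : X → Type) [∀ x, AddCommGroup (F x)]
    [∀ x, Module (A.Stalk x) (F x)] (G : ∀ U : Opens X, Set (∀ x : U, F x))
    (hG : ∀ {U V : Opens X} (h : V ≤ U), ∀ s ∈ G U, restr h s ∈ G V) : ModSheaf A where
  Stalk := F
  sec U :=
    { carrier := {s | ∀ x : U, ∃ (V : Opens X) (h : V ≤ U), x.1 ∈ V ∧
        restr h s ∈ Submodule.span (A.sec V) (G V)}
      zero_mem' := fun x => ⟨U, le_rfl, x.2, Submodule.zero_mem _⟩
      add_mem' := by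
        intro s t hs ht x
        obtain ⟨V, hV, hxV, hsV⟩ := hs x
        obtain ⟨W, hW, hxW, htW⟩ := ht x
        exact ⟨V ⊓ W, inf_le_left.trans hV, ⟨hxV, hxW⟩, Submodule.add_mem _
          (restr_mem_span G hG (inf_le_left : V ⊓ W ≤ V) _ hsV)
          (restr_mem_span G hG (inf_le_right : V ⊓ W ≤ W) _ htW)⟩
      smul_mem' := by
        intro a s hs x
        obtain ⟨V, hV, hxV, hsV⟩ := hs x
        exact ⟨V, hV, hxV, Submodule.smul_mem _ (A.res hV a) hsV⟩ }
  restr_mem := by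
    intro U V h s hs x
    obtain ⟨W, hW, hxW, hsW⟩ := hs ⟨x.1, h x.2⟩
    exact ⟨V ⊓ W, inf_le_left, ⟨x.2, hxW⟩,
      restr_mem_span G hG (inf_le_right : V ⊓ W ≤ W) _ hsW⟩
  glue_mem := by
    intro U s hs x
    obtain ⟨V, hV, hxV, hsV⟩ := hs x
    obtain ⟨W, hW, hxW, hsW⟩ := hsV ⟨x.1, hxV⟩
    exact ⟨W, hW.trans hV, hxW, hsW⟩

/-! ### Kähler differentials -/

/-- The sheaf of Kähler differentials of `A` over `ℂ`, i.e. the sheaf associated with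
`U ↦ Ω[A(U)⁄ℂ]`. Its stalk at `x` is `Ω[A_x⁄ℂ]`, and `Ω[A(V)⁄ℂ]` is spanned over `A(V)` by the
differentials `db` with `b ∈ A(V)`. -/
def kaehler (A : AlgSheaf X) : ModSheaf A :=
  ModSheaf.generate A (fun x => Ω[A.Stalk x⁄ℂ])
    (fun U => {w | ∃ b : A.sec U, w = fun x : U => KaehlerDifferential.D ℂ (A.Stalk x) (b.1 x)})
    (by
      rintro U V h _ ⟨b, rfl⟩
      exact ⟨A.res h b, rfl⟩)

/-- The universal differential `d : A(U) → 𝒜¹(U)`. -/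
def dif {A : AlgSheaf X} {U : Opens X} (b : A.sec U) : (kaehler A).sec U :=
  ⟨fun x => KaehlerDifferential.D ℂ (A.Stalk x) (b.1 x),
    fun x => ⟨U, le_rfl, x.2, Submodule.subset_span ⟨b, rfl⟩⟩⟩

/-! ### Tensor products -/

/-- The tensor product `M ⊗_A N` of sheaves of modules, i.e. the sheaf associated with
`U ↦ M(U) ⊗_{A(U)} N(U)`; its stalk at `x` is `M_x ⊗_{A_x} N_x`. -/
def tensor {A : AlgSheaf X} (M N : ModSheaf A) : ModSheaf A :=
  ModSheaf.generate A (fun x => M.Stalk x ⊗[A.Stalk x] N.Stalk x)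
    (fun U => {w | ∃ (m : M.sec U) (n : N.sec U), w = fun x : U => m.1 x ⊗ₜ n.1 x})
    (by
      rintro U V h _ ⟨m, n, rfl⟩
      exact ⟨M.res h m, N.res h n, rfl⟩)

/-- The canonical map `θ_U : M(U) ⊗_{A(U)} N(U) → (M ⊗_A N)(U)`. -/
def theta {A : AlgSheaf X} (M N : ModSheaf A) (U : Opens X) :
    M.sec U ⊗[A.sec U] N.sec U →ₗ[A.sec U] (tensor M N).sec U :=
  TensorProduct.lift (LinearMap.mk₂ (A.sec U)
    (fun m n => (⟨fun x => m.1 x ⊗ₜ n.1 x,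
      fun x => ⟨U, le_rfl, x.2, Submodule.subset_span ⟨m, n, rfl⟩⟩⟩ : (tensor M N).sec U))
    (fun _ _ _ => Subtype.ext (funext fun _ => TensorProduct.add_tmul _ _ _))
    (fun _ _ _ => Subtype.ext (funext fun _ => (TensorProduct.smul_tmul' _ _ _).symm))
    (fun _ _ _ => Subtype.ext (funext fun _ => TensorProduct.tmul_add _ _ _))
    (fun _ _ _ => Subtype.ext (funext fun _ => TensorProduct.tmul_smul _ _ _)))

/-! ### Connections -/

/-- A connection on the `A`-module `M`: a morphism of sheaves `∇ : M → 𝒜¹ ⊗_A M` satisfying the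
Leibniz rule `∇(g s) = θ(dg ⊗ s) + g ∇s`. (`ℂ`-linearity follows from additivity and the Leibniz
rule, because `d` vanishes on constants.) -/
@[ext]
structure Connection {A : AlgSheaf X} (M : ModSheaf A) where
  app : ∀ U : Opens X, M.sec U →+ (tensor (kaehler A) M).sec U
  naturality : ∀ {U V : Opens X} (h : V ≤ U) (s : M.sec U),
    app V (M.res h s) = (tensor (kaehler A) M).res h (app U s)
  leibniz : ∀ (U : Opens X) (g : A.sec U) (s : M.sec U),
    app U (g • s) = theta (kaehler A) M U (dif g ⊗ₜ s) + g • app U s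

/-- `σ` is a frame of the rank one module `M` over `U`: multiplication by `σ` is an isomorphism
`A|_U → M|_U`, that is, it is bijective on all stalks. -/
def IsFrame {A : AlgSheaf X} (M : ModSheaf A) {U : Opens X} (σ : M.sec U) : Prop :=
  ∀ x : U, Function.Bijective fun a : A.Stalk x => a • σ.1 x

/-! ### Inverse images -/

/-- The inverse image sheaf `j⁻¹A`: its sections over `U` are the families of germs
`s_y ∈ A_{j(y)}`, `y ∈ U`, which are locally induced by sections of `A` over open sets of `X`. -/
def AlgSheaf.inverseImage (j : C(Y, X)) (A : AlgSheaf X) : AlgSheaf Y where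
  Stalk y := A.Stalk (j y)
  sec U :=
    { carrier := {s | ∀ y : U, ∃ (V : Opens Y) (W : Opens X) (t : A.sec W), y.1 ∈ V ∧
        ∀ z : U, z.1 ∈ V → ∃ hz : j z ∈ W, s z = t.1 ⟨j z, hz⟩}
      mul_mem' := by
        intro s s' hs hs' y
        obtain ⟨V, W, t, hy, ht⟩ := hs y
        obtain ⟨V', W', t', hy', ht'⟩ := hs' y
        refine ⟨V ⊓ V', W ⊓ W', A.res inf_le_left t * A.res inf_le_right t', ⟨hy, hy'⟩,
          fun z hz => ?_⟩
        obtain ⟨h, e⟩ := ht z hz.1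
        obtain ⟨h', e'⟩ := ht' z hz.2
        exact ⟨⟨h, h'⟩, congrArg₂ (· * ·) e e'⟩
      add_mem' := by
        intro s s' hs hs' y
        obtain ⟨V, W, t, hy, ht⟩ := hs y
        obtain ⟨V', W', t', hy', ht'⟩ := hs' y
        refine ⟨V ⊓ V', W ⊓ W', A.res inf_le_left t + A.res inf_le_right t', ⟨hy, hy'⟩,
          fun z hz => ?_⟩
        obtain ⟨h, e⟩ := ht z hz.1
        obtain ⟨h', e'⟩ := ht' z hz.2
        exact ⟨⟨h, h'⟩, congrArg₂ (· + ·) e e'⟩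
      algebraMap_mem' := fun c y =>
        ⟨⊤, ⊤, algebraMap ℂ _ c, trivial, fun _ _ => ⟨trivial, rfl⟩⟩ }
  restr_mem := by
    intro U V h s hs y
    obtain ⟨V', W, t, hy, ht⟩ := hs ⟨y.1, h y.2⟩
    exact ⟨V', W, t, hy, fun z hz => ht ⟨z.1, h z.2⟩ hz⟩
  glue_mem := by
    intro U s hs y
    obtain ⟨V, hV, hyV, hsV⟩ := hs y
    obtain ⟨V', W, t, hy, ht⟩ := hsV ⟨y.1, hyV⟩
    exact ⟨V ⊓ V', W, t, ⟨hyV, hy⟩, fun z hz => ht ⟨z.1, hz.1⟩ hz.2⟩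

instance (j : C(Y, X)) {A : AlgSheaf X} (M : ModSheaf A) (y : Y) :
    Module ((A.inverseImage j).Stalk y) (M.Stalk (j y)) :=
  M.module (j y)

/-- The inverse image `j⁻¹M` of a sheaf of `A`-modules, a sheaf of `j⁻¹A`-modules. -/
def ModSheaf.inverseImage (j : C(Y, X)) {A : AlgSheaf X} (M : ModSheaf A) :
    ModSheaf (A.inverseImage j) where
  Stalk y := M.Stalk (j y)
  addCommGroup y := M.addCommGroup (j y)
  module y := M.module (j y)
  sec U :=
    { carrier := {s | ∀ y : U, ∃ (V : Opens Y) (W : Opens X) (t : M.sec W), y.1 ∈ V ∧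
        ∀ z : U, z.1 ∈ V → ∃ hz : j z ∈ W, s z = t.1 ⟨j z, hz⟩}
      zero_mem' := fun y => ⟨⊤, ⊤, 0, trivial, fun _ _ => ⟨trivial, rfl⟩⟩
      add_mem' := by
        intro s s' hs hs' y
        obtain ⟨V, W, t, hy, ht⟩ := hs y
        obtain ⟨V', W', t', hy', ht'⟩ := hs' y
        refine ⟨V ⊓ V', W ⊓ W', M.res inf_le_left t + M.res inf_le_right t', ⟨hy, hy'⟩,
          fun z hz => ?_⟩
        obtain ⟨h, e⟩ := ht z hz.1
        obtain ⟨h', e'⟩ := ht' z hz.2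
        refine ⟨⟨h, h'⟩, ?_⟩
        change s z + s' z = _
        rw [e, e']
        rfl
      smul_mem' := by
        intro a s hs y
        obtain ⟨V, W, t, hy, ht⟩ := a.2 y
        obtain ⟨V', W', t', hy', ht'⟩ := hs y
        refine ⟨V ⊓ V', W ⊓ W',
          A.res (inf_le_left : W ⊓ W' ≤ W) t • M.res (inf_le_right : W ⊓ W' ≤ W') t',
          ⟨hy, hy'⟩, fun z hz => ?_⟩
        obtain ⟨h, e⟩ := ht z hz.1
        obtain ⟨h', e'⟩ := ht' z hz.2
        refine ⟨⟨h, h'⟩, ?_⟩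
        change a.1 z • s z = _
        rw [e, e']
        rfl }
  restr_mem := by
    intro U V h s hs y
    obtain ⟨V', W, t, hy, ht⟩ := hs ⟨y.1, h y.2⟩
    exact ⟨V', W, t, hy, fun z hz => ht ⟨z.1, h z.2⟩ hz⟩
  glue_mem := by
    intro U s hs y
    obtain ⟨V, hV, hyV, hsV⟩ := hs y
    obtain ⟨V', W, t, hy, ht⟩ := hsV ⟨y.1, hyV⟩
    exact ⟨V ⊓ V', W, t, ⟨hyV, hy⟩, fun z hz => ht ⟨z.1, hz.1⟩ hz.2⟩

/-! ### Change of the sheaf of rings -/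

/-- A morphism of sheaves of `ℂ`-algebras. -/
structure AlgSheaf.Hom (A B : AlgSheaf X) where
  stalk : ∀ x, A.Stalk x →ₐ[ℂ] B.Stalk x
  map_mem : ∀ {U : Opens X} (s : ∀ x : U, A.Stalk x), s ∈ A.sec U →
    (fun x : U => stalk x (s x)) ∈ B.sec U

/-- The map `f_U : A(U) → B(U)`. -/
def AlgSheaf.Hom.app {A B : AlgSheaf X} (f : A.Hom B) {U : Opens X} (s : A.sec U) : B.sec U :=
  ⟨fun x => f.stalk x (s.1 x), f.map_mem s.1 s.2⟩

/-- `B_x` as an algebra over `A_x`. -/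
abbrev AlgSheaf.Hom.algebra {A B : AlgSheaf X} (f : A.Hom B) (x : X) :
    Algebra (A.Stalk x) (B.Stalk x) :=
  (f.stalk x).toRingHom.toAlgebra

theorem AlgSheaf.Hom.isScalarTower {A B : AlgSheaf X} (f : A.Hom B) (x : X) :
    letI := f.algebra x
    IsScalarTower ℂ (A.Stalk x) (B.Stalk x) :=
  letI := f.algebra x
  IsScalarTower.of_algebraMap_eq fun c => ((f.stalk x).commutes c).symm

/-- `B_x ⊗_{A_x} M_x`. -/
abbrev BaseChangeStalk {A B : AlgSheaf X} (f : A.Hom B) (M : ModSheaf A) (x : X) : Type :=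
  letI := f.algebra x
  B.Stalk x ⊗[A.Stalk x] M.Stalk x

/-- The element `b ⊗ m` of `B_x ⊗_{A_x} M_x`. -/
def baseChangeTmul {A B : AlgSheaf X} (f : A.Hom B) (M : ModSheaf A) (x : X)
    (b : B.Stalk x) (m : M.Stalk x) : BaseChangeStalk f M x :=
  letI := f.algebra x
  b ⊗ₜ[A.Stalk x] m

instance {A B : AlgSheaf X} (f : A.Hom B) (M : ModSheaf A) (x : X) :
    Module (B.Stalk x) (BaseChangeStalk f M x) :=
  letI := f.algebra x
  TensorProduct.leftModule

/-- The sheaf of `B`-modules `B ⊗_A M`, i.e. the sheaf associated with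
`U ↦ B(U) ⊗_{A(U)} M(U)`; its stalk at `x` is `B_x ⊗_{A_x} M_x`. -/
def baseChange {A B : AlgSheaf X} (f : A.Hom B) (M : ModSheaf A) : ModSheaf B :=
  ModSheaf.generate B (BaseChangeStalk f M)
    (fun U => {w | ∃ (b : B.sec U) (m : M.sec U),
      w = fun x : U => baseChangeTmul f M x (b.1 x) (m.1 x)})
    (by
      rintro U V h _ ⟨b, m, rfl⟩
      exact ⟨B.res h b, M.res h m, rfl⟩)

/-- The section `1 ⊗ m` of `B ⊗_A M` defined by a section `m` of `M`. -/
def oneTmul {A B : AlgSheaf X} (f : A.Hom B) {M : ModSheaf A} {U : Opens X} (m : M.sec U) :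
    (baseChange f M).sec U :=
  ⟨fun x => baseChangeTmul f M x 1 (m.1 x),
    fun x => ⟨U, le_rfl, x.2, Submodule.subset_span ⟨1, m, rfl⟩⟩⟩

/-- The stalk `B_x ⊗_{A_x} Ω[A_x⁄ℂ] → Ω[B_x⁄ℂ]`, `c ⊗ db ↦ c d(f(b))`, of the conormal map. -/
def conormalStalk {A B : AlgSheaf X} (f : A.Hom B) (x : X) :
    BaseChangeStalk f (kaehler A) x →ₗ[B.Stalk x] Ω[B.Stalk x⁄ℂ] :=
  letI := f.algebra x
  haveI := f.isScalarTower x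
  KaehlerDifferential.mapBaseChange ℂ (A.Stalk x) (B.Stalk x)

theorem conormalStalk_tmul_D {A B : AlgSheaf X} (f : A.Hom B) (x : X) (c : B.Stalk x)
    (b : A.Stalk x) :
    conormalStalk f x (baseChangeTmul f (kaehler A) x c (KaehlerDifferential.D ℂ (A.Stalk x) b)) =
      c • KaehlerDifferential.D ℂ (B.Stalk x) (f.stalk x b) := by
  let := f.algebra x
  have := f.isScalarTower x
  refine (KaehlerDifferential.mapBaseChange_tmul ℂ (A.Stalk x) (B.Stalk x) c _).trans ?_
  rw [KaehlerDifferential.map_D]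
  rfl

theorem baseChangeTmul_add {A B : AlgSheaf X} (f : A.Hom B) (M : ModSheaf A) (x : X)
    (b : B.Stalk x) (m m' : M.Stalk x) : baseChangeTmul f M x b (m + m') =
      baseChangeTmul f M x b m + baseChangeTmul f M x b m' :=
  letI := f.algebra x
  TensorProduct.tmul_add _ _ _

theorem baseChangeTmul_zero {A B : AlgSheaf X} (f : A.Hom B) (M : ModSheaf A) (x : X)
    (b : B.Stalk x) : baseChangeTmul f M x b (0 : M.Stalk x) = 0 :=
  letI := f.algebra x
  TensorProduct.tmul_zero _ _

theorem baseChangeTmul_smul {A B : AlgSheaf X} (f : A.Hom B) (M : ModSheaf A) (x : X)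
    (b : B.Stalk x) (a : A.Stalk x) (m : M.Stalk x) : baseChangeTmul f M x b (a • m) =
      f.stalk x a • baseChangeTmul f M x b m := by
  let := f.algebra x
  change b ⊗ₜ[A.Stalk x] (a • m) = f.stalk x a • (b ⊗ₜ[A.Stalk x] m)
  rw [← TensorProduct.smul_tmul, TensorProduct.smul_tmul']
  rfl

theorem conormalStalk_tmul_mem {A B : AlgSheaf X} (f : A.Hom B) {U : Opens X}
    (c : B.sec U) (w : (kaehler A).sec U) :
    (fun x : U => conormalStalk f x (baseChangeTmul f (kaehler A) x (c.1 x) (w.1 x))) ∈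
      (kaehler B).sec U := by
  intro x
  obtain ⟨V, hV, hxV, hw⟩ := w.2 x
  refine ⟨V, hV, hxV, ?_⟩
  have key : ∀ w : (∀ x : V, Ω[A.Stalk x⁄ℂ]), w ∈ Submodule.span (A.sec V)
      {w | ∃ b : A.sec V, w = fun x : V => KaehlerDifferential.D ℂ (A.Stalk x) (b.1 x)} →
      (fun x : V => conormalStalk f x (baseChangeTmul f (kaehler A) x ((B.res hV c).1 x) (w x))) ∈
      Submodule.span (B.sec V)
        {w | ∃ b : B.sec V, w = fun x : V => KaehlerDifferential.D ℂ (B.Stalk x) (b.1 x)} := by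
    intro w hw
    induction hw using Submodule.span_induction with
    | mem w hw =>
      obtain ⟨b, rfl⟩ := hw
      have h : (fun x : V => KaehlerDifferential.D ℂ (B.Stalk x) ((f.app b).1 x)) ∈
          {w | ∃ b : B.sec V, w = fun x : V => KaehlerDifferential.D ℂ (B.Stalk x) (b.1 x)} :=
        ⟨f.app b, rfl⟩
      convert Submodule.smul_mem _ (B.res hV c) (Submodule.subset_span h) using 1
      funext x
      exact conormalStalk_tmul_D f x _ _
    | zero =>
      convert Submodule.zero_mem _ using 1
      funext x
      exact (congrArg _ (baseChangeTmul_zero f (kaehler A) x _)).trans (map_zero _)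
    | add w w' _ _ hw hw' =>
      convert Submodule.add_mem _ hw hw' using 1
      funext x
      exact (congrArg _ (baseChangeTmul_add f (kaehler A) x _ _ _)).trans (map_add _ _ _)
    | smul a w _ hw =>
      convert Submodule.smul_mem _ (f.app a) hw using 1
      funext x
      exact (congrArg _ (baseChangeTmul_smul f (kaehler A) x _ _ _)).trans (map_smul _ _ _)
  exact key _ hw

/-- The conormal map `q_U : (B ⊗_A 𝒜¹_A)(U) → 𝒜¹_B(U)`, `c ⊗ db ↦ c d(f(b))`. -/
def conormal {A B : AlgSheaf X} (f : A.Hom B) (U : Opens X) :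
    (baseChange f (kaehler A)).sec U →ₗ[B.sec U] (kaehler B).sec U where
  toFun s := ⟨fun x => conormalStalk f x (s.1 x), by
    refine (kaehler B).glue_mem U _ fun x => ?_
    obtain ⟨V, hV, hxV, hs⟩ := s.2 x
    refine ⟨V, hV, hxV, ?_⟩
    have key : ∀ s : (∀ x : V, BaseChangeStalk f (kaehler A) x),
        s ∈ Submodule.span (B.sec V) {w | ∃ (b : B.sec V) (m : (kaehler A).sec V),
          w = fun x : V => baseChangeTmul f (kaehler A) x (b.1 x) (m.1 x)} →
        (fun x : V => conormalStalk f x (s x)) ∈ (kaehler B).sec V := by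
      intro s hs
      induction hs using Submodule.span_induction with
      | mem w hw =>
        obtain ⟨b, m, rfl⟩ := hw
        exact conormalStalk_tmul_mem f b m
      | zero =>
        exact ModSheaf.mem_of_eq (kaehler B) (funext fun x => map_zero (conormalStalk f x))
          (Submodule.zero_mem ((kaehler B).sec V))
      | add w w' _ _ hw hw' =>
        exact ModSheaf.mem_of_eq (kaehler B) (funext fun x => map_add (conormalStalk f x) _ _)
          (Submodule.add_mem ((kaehler B).sec V) hw hw')
      | smul a w _ hw =>
        exact ModSheaf.mem_of_eq (kaehler B) (funext fun x => map_smul (conormalStalk f x) _ _)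
          (Submodule.smul_mem ((kaehler B).sec V) a hw)
    exact key _ hs⟩
  map_add' _ _ := Subtype.ext (funext fun _ => map_add _ _ _)
  map_smul' _ _ := Subtype.ext (funext fun _ => map_smul (conormalStalk f _) _ _)

/-! ### Sheaves of functions -/

instance {α : Type} (l : Filter α) : Algebra ℂ (Germ l ℂ) :=
  Algebra.ofModule
    (fun c f g => Germ.inductionOn₂ f g fun _ _ =>
      congrArg Germ.ofFun (funext fun _ => smul_mul_assoc c _ _))
    (fun c f g => Germ.inductionOn₂ f g fun _ _ =>
      congrArg Germ.ofFun (funext fun _ => mul_smul_comm c _ _))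

/-- Composition of germs of functions with a map. -/
def germComp {α β : Type} {la : Filter α} {lb : Filter β} (g : β → α) (hg : Tendsto g lb la) :
    Germ la ℂ →ₐ[ℂ] Germ lb ℂ where
  toFun f := f.compTendsto g hg
  map_one' := rfl
  map_zero' := rfl
  map_mul' f f' := Germ.inductionOn₂ f f' fun _ _ => rfl
  map_add' f f' := Germ.inductionOn₂ f f' fun _ _ => rfl
  commutes' _ := rfl

/-- The sheaf of the functions `f` on open sets `U` whose germ at every `x ∈ U` belongs to `S x`.
(The values outside `U` of the function `f : X → ℂ` below are irrelevant.) -/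
def funSheaf (S : ∀ x : X, Subalgebra ℂ (Germ (𝓝 x) ℂ)) : AlgSheaf X where
  Stalk x := S x
  sec U :=
    { carrier := {s | ∃ f : X → ℂ, ∀ x : U, ((s x : S x) : Germ (𝓝 x.1) ℂ) = f}
      mul_mem' := by
        rintro s t ⟨f, hf⟩ ⟨g, hg⟩
        exact ⟨f * g, fun x => congrArg₂ (· * ·) (hf x) (hg x)⟩
      add_mem' := by
        rintro s t ⟨f, hf⟩ ⟨g, hg⟩
        exact ⟨f + g, fun x => congrArg₂ (· + ·) (hf x) (hg x)⟩
      algebraMap_mem' := fun c => ⟨c • 1, fun _ => rfl⟩ }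
  restr_mem := by
    rintro U V h s ⟨f, hf⟩
    exact ⟨f, fun x => hf ⟨x.1, h x.2⟩⟩
  glue_mem := by
    intro U s hs
    choose V hV hxV f hf using hs
    classical
    refine ⟨fun x => if hx : x ∈ U then f ⟨x, hx⟩ x else 0, fun x => (hf x ⟨x.1, hxV x⟩).trans ?_⟩
    refine Germ.coe_eq.mpr ?_
    filter_upwards [(V x).isOpen.mem_nhds (hxV x)] with y hy
    have hyU : y ∈ U := hV x hy
    have h1 := hf x ⟨y, hy⟩
    have h2 := hf ⟨y, hyU⟩ ⟨y, hxV ⟨y, hyU⟩⟩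
    have h3 : (f x : Germ (𝓝 y) ℂ) = f ⟨y, hyU⟩ := h1.symm.trans h2
    rw [dif_pos hyU]
    exact (Germ.coe_eq.mp h3).eq_of_nhds

/-! ### Complex projective space and its smooth functions -/

/-- `ℙ^N(ℂ)`. -/
abbrev PN (N : ℕ) : Type := ℙ ℂ (Fin (N + 1) → ℂ)

/-- The nonzero vectors of `ℂ^{N+1}`, an open submanifold. -/
def punctured (N : ℕ) : Opens (Fin (N + 1) → ℂ) := ⟨{v | v ≠ 0}, isOpen_ne⟩

/-- The projection `ℂ^{N+1} ∖ {0} → ℙ^N`. -/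
def proj {N : ℕ} (v : punctured N) : PN N := Projectivization.mk ℂ v.1 v.2

/-- The quotient topology on `ℙ^N`. -/
instance (N : ℕ) : TopologicalSpace (PN N) := TopologicalSpace.coinduced proj inferInstance

/-- `f` is smooth (of class `C^∞` in the real sense) at `x`: its pullback to
`ℂ^{N+1} ∖ {0}` is smooth at all points over `x`. -/
def IsSmoothAt {N : ℕ} (f : PN N → ℂ) (x : PN N) : Prop :=
  ∀ v : punctured N, proj v = x →
    ContMDiffAt 𝓘(ℝ, Fin (N + 1) → ℂ) 𝓘(ℝ, ℂ) ∞ (fun w : punctured N => f (proj w)) v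

theorem contMDiffAt_mul {N : ℕ} {F G : punctured N → ℂ} {v : punctured N}
    (hF : ContMDiffAt 𝓘(ℝ, Fin (N + 1) → ℂ) 𝓘(ℝ, ℂ) ∞ F v)
    (hG : ContMDiffAt 𝓘(ℝ, Fin (N + 1) → ℂ) 𝓘(ℝ, ℂ) ∞ G v) :
    ContMDiffAt 𝓘(ℝ, Fin (N + 1) → ℂ) 𝓘(ℝ, ℂ) ∞ (fun w => F w * G w) v :=
  ContDiffAt.comp_contMDiffAt (g := fun p : ℂ × ℂ => p.1 * p.2) contDiff_mul.contDiffAt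
    (hF.prodMk_space hG)

/-- The algebra of germs at `x` of smooth complex functions on `ℙ^N`. -/
def smoothGerms {N : ℕ} (x : PN N) : Subalgebra ℂ (Germ (𝓝 x) ℂ) where
  carrier := {g | ∃ f : PN N → ℂ, g = f ∧ ∀ᶠ x' in 𝓝 x, IsSmoothAt f x'}
  mul_mem' := by
    rintro _ _ ⟨f, rfl, hf⟩ ⟨g, rfl, hg⟩
    refine ⟨f * g, rfl, ?_⟩
    filter_upwards [hf, hg] with y hy hy' v hv using contMDiffAt_mul (hy v hv) (hy' v hv)
  add_mem' := by
    rintro _ _ ⟨f, rfl, hf⟩ ⟨g, rfl, hg⟩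
    refine ⟨f + g, rfl, ?_⟩
    filter_upwards [hf, hg] with y hy hy' v hv using (hy v hv).add (hy' v hv)
  algebraMap_mem' := fun c =>
    ⟨fun _ => c * 1, congrArg Germ.ofFun (funext fun _ => rfl),
      Eventually.of_forall fun _ _ _ => contMDiffAt_const⟩

/-- The sheaf `𝒜_ℙ` of smooth complex functions on `ℙ^N`. -/
def smoothSheafPN (N : ℕ) : AlgSheaf (PN N) := funSheaf smoothGerms

/-! ### The line bundle `𝒪(1)` -/

/-- The filter of the cones over the neighbourhoods of `x`. -/
def coneNhds {N : ℕ} (x : PN N) : Filter (punctured N) := comap proj (𝓝 x)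

/-- Functions on `ℙ^N` multiply functions on `ℂ^{N+1} ∖ {0}`. -/
instance {N : ℕ} (x : PN N) : Module (Germ (𝓝 x) ℂ) (Germ (coneNhds x) ℂ) :=
  Module.compHom _ (germComp (la := 𝓝 x) (lb := coneNhds x) proj tendsto_comap).toRingHom

/-- The germs at `x` of smooth sections of `𝒪(1)`: germs, along the line `x`, of smooth functions
`F` on `ℂ^{N+1} ∖ {0}` that are homogeneous of degree one, `F(c v) = c F(v)`. -/
def sectionGerms {N : ℕ} (x : PN N) : Submodule (smoothGerms x) (Germ (coneNhds x) ℂ) where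
  carrier := {g | ∃ F : punctured N → ℂ, g = F ∧ ∀ᶠ v in coneNhds x,
    ContMDiffAt 𝓘(ℝ, Fin (N + 1) → ℂ) 𝓘(ℝ, ℂ) ∞ F v ∧
      ∀ (c : ℂ) (w : punctured N), w.1 = c • v.1 → F w = c * F v}
  zero_mem' := ⟨0, rfl, Eventually.of_forall fun _ => ⟨contMDiffAt_const, by simp⟩⟩
  add_mem' := by
    rintro _ _ ⟨F, rfl, hF⟩ ⟨G, rfl, hG⟩
    refine ⟨F + G, rfl, ?_⟩
    filter_upwards [hF, hG] with v hv hv'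
    refine ⟨hv.1.add hv'.1, fun c w h => ?_⟩
    rw [Pi.add_apply, Pi.add_apply, hv.2 c w h, hv'.2 c w h, mul_add]
  smul_mem' := by
    rintro ⟨_, h⟩ _ ⟨F, rfl, hF⟩
    obtain ⟨f, rfl, hf⟩ := h
    refine ⟨fun v => f (proj v) * F v, rfl, ?_⟩
    filter_upwards [tendsto_comap.eventually hf, hF] with v hv hv'
    refine ⟨contMDiffAt_mul (hv v rfl) hv'.1, fun c w h => ?_⟩
    have e : proj w = proj v := (Projectivization.mk_eq_mk_iff' ℂ _ _ w.2 v.2).mpr ⟨c, h.symm⟩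
    rw [e, hv'.2 c w h, mul_left_comm]

instance {N : ℕ} (x : PN N) : Module ((smoothSheafPN N).Stalk x) (sectionGerms x) :=
  inferInstanceAs (Module (smoothGerms x) (sectionGerms x))

/-- The sheaf `𝒪(1)` of smooth sections of the hyperplane bundle on `ℙ^N`, as a module over the
smooth functions: a section over `W` is a smooth function on the cone over `W` that is homogeneous
of degree one. (The values of `F : ℂ^{N+1} ∖ {0} → ℂ` outside this cone are irrelevant.) -/
def O1 (N : ℕ) : ModSheaf (smoothSheafPN N) where
  Stalk x := sectionGerms x
  sec W :=
    { carrier := {s | ∃ F : punctured N → ℂ,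
        ∀ x : W, ((s x : sectionGerms x.1) : Germ (coneNhds x.1) ℂ) = F}
      zero_mem' := ⟨0, fun _ => rfl⟩
      add_mem' := by
        rintro s t ⟨F, hF⟩ ⟨G, hG⟩
        exact ⟨F + G, fun x => congrArg₂ (· + ·) (hF x) (hG x)⟩
      smul_mem' := by
        rintro ⟨a, f, hf⟩ s ⟨F, hF⟩
        exact ⟨fun v => f (proj v) * F v, fun x => congrArg₂ (· • ·) (hf x) (hF x)⟩ }
  restr_mem := by
    rintro U V h s ⟨F, hF⟩
    exact ⟨F, fun x => hF ⟨x.1, h x.2⟩⟩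
  glue_mem := by
    intro U s hs
    choose V hV hxV F hF using hs
    classical
    refine ⟨fun v => if hv : proj v ∈ U then F ⟨proj v, hv⟩ v else 0,
      fun x => (hF x ⟨x.1, hxV x⟩).trans ?_⟩
    refine Germ.coe_eq.mpr ?_
    have hmem : ∀ᶠ v in coneNhds x.1, proj v ∈ V x :=
      tendsto_comap.eventually ((V x).isOpen.mem_nhds (hxV x))
    filter_upwards [hmem] with v hv
    have hvU : proj v ∈ U := hV x hv
    have h1 := hF x ⟨proj v, hv⟩
    have h2 := hF ⟨proj v, hvU⟩ ⟨proj v, hxV ⟨proj v, hvU⟩⟩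
    have h3 : (F x : Germ (coneNhds (proj v)) ℂ) = F ⟨proj v, hvU⟩ := h1.symm.trans h2
    rw [dif_pos hvU]
    obtain ⟨T, hT, hTs⟩ := mem_comap.mp (Germ.coe_eq.mp h3)
    exact hTs (mem_of_mem_nhds hT : proj v ∈ T)

/-! ### Subsets of projective space -/

variable {N : ℕ}

/-- The inclusion `j : Y ↪ ℙ^N`. -/
def incl (Y : Set (PN N)) : C(Y, PN N) := ⟨Subtype.val, continuous_subtype_val⟩

/-- The sheaf `𝒜_Y` of smooth functions on `Y`: functions on open sets of `Y` that are locally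
restrictions of smooth functions on open sets of `ℙ^N`. -/
def smoothSheafOn (Y : Set (PN N)) : AlgSheaf Y :=
  funSheaf fun y => (smoothGerms (incl Y y)).map (germComp (incl Y) ((incl Y).continuous.tendsto y))

/-- The sheaf `ℛ = j⁻¹𝒜_ℙ`. -/
def sheafR (Y : Set (PN N)) : AlgSheaf Y := (smoothSheafPN N).inverseImage (incl Y)

/-- The epimorphism `π : ℛ → 𝒜_Y` that restricts functions to `Y`. -/
def restrictionHom (Y : Set (PN N)) : (sheafR Y).Hom (smoothSheafOn Y) where
  stalk y := ((germComp (incl Y) ((incl Y).continuous.tendsto y)).comp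
    (smoothGerms (incl Y y)).val).codRestrict _ fun g => ⟨g.1, g.2, rfl⟩
  map_mem := by
    intro U s hs
    refine (smoothSheafOn Y).glue_mem U _ fun y => ?_
    obtain ⟨V, W, ⟨t, f, hf⟩, hy, ht⟩ := hs y
    refine ⟨U ⊓ V, inf_le_left, ⟨y.2, hy⟩, fun z => f (incl Y z), fun z => ?_⟩
    obtain ⟨hz, e⟩ := ht ⟨z.1, z.2.1⟩ z.2.2
    have e' : (smoothGerms (incl Y z.1)).val (s ⟨z.1, z.2.1⟩) = f :=
      (congrArg Subtype.val e).trans (hf ⟨incl Y z.1, hz⟩)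
    exact congrArg (germComp (incl Y) ((incl Y).continuous.tendsto z.1)) e'

/-- The `C^∞` line bundle `𝖫 = 𝒜_Y ⊗_ℛ j⁻¹𝒪(1)`. -/
def bundleL (Y : Set (PN N)) : ModSheaf (smoothSheafOn Y) :=
  baseChange (restrictionHom Y) ((O1 N).inverseImage (incl Y))

/-- `αt` is the connection form `j⁻¹(α̃) ∈ 𝒜¹_ℛ(U)` of the connection `∇̃` on `𝒪(1)` in the frame
`σt = j⁻¹(σ̃)`: locally on `U` both are induced by sections `σ̃_W ∈ 𝒪(1)(W)` and
`α̃_W ∈ 𝒜¹_ℙ(W)` over open sets `W ⊆ ℙ^N` with `∇̃ σ̃_W = α̃_W ⊗ σ̃_W`. -/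
def IsConnectionForm {Y : Set (PN N)} (nablat : Connection (O1 N)) {U : Opens Y}
    (σt : ((O1 N).inverseImage (incl Y)).sec U) (αt : (kaehler (sheafR Y)).sec U) : Prop :=
  ∀ y : U, ∃ (W : Opens (PN N)) (σW : (O1 N).sec W) (αW : (kaehler (smoothSheafPN N)).sec W),
    incl Y y ∈ W ∧ nablat.app W σW = theta (kaehler (smoothSheafPN N)) (O1 N) W (αW ⊗ₜ σW) ∧
      ∀ (z : U) (hz : incl Y z ∈ W),
        σt.1 z = σW.1 ⟨incl Y z, hz⟩ ∧ αt.1 z = αW.1 ⟨incl Y z, hz⟩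

/-- The form `α_U = q_U(1 ⊗ j⁻¹(α̃)) ∈ 𝒜¹_Y(U)`. -/
def inducedForm {Y : Set (PN N)} {U : Opens Y} (αt : (kaehler (sheafR Y)).sec U) :
    (kaehler (smoothSheafOn Y)).sec U :=
  conormal (restrictionHom Y) U (oneTmul (restrictionHom Y) αt)

/-- The section `1 ⊗ σt` of `𝖫` defined by a section `σt` of `j⁻¹𝒪(1)`. -/
def inducedSection {Y : Set (PN N)} {U : Opens Y}
    (σt : ((O1 N).inverseImage (incl Y)).sec U) : (bundleL Y).sec U :=
  oneTmul (restrictionHom Y) σt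

end GermSheaf

end

open GermSheaf

/-!
A line bundle is generated freely by a single element on each stalk, so a connection on it is
given by Leibniz maps on the stalks, and on a stalk such a map is determined by its value `α ⊗ σ` on
a generator `σ`. The chain rule `D (a σ) = (da + a α) ⊗ σ` then yields the gauge transformation
rule, and it shows that inverse images and base changes of connections exist, which gives `∇` from
`∇̃`.

For existence and uniqueness of the connection form, a section `σ̃` of `j⁻¹𝒪(1)` inducing a frame
of `𝖫` has to be a frame itself. This holds because `π` reflects invertibility: a smooth function
not vanishing at a point of `Y` is invertible on a neighbourhood of that point in `ℙ^N`.
-/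

noncomputable section

namespace GermSheaf

section FreeGenerator

variable {R M : Type*} [CommRing R] [AddCommGroup M] [Module R M]

variable (R) in
/-- `σ` generates the module `M` freely, that is, `{σ}` is a basis of `M`. A frame of a sheaf of
modules is a section whose germs are free generators of the stalks. -/
def IsFreeGenerator (σ : M) : Prop :=
  Function.Bijective fun a : R => a • σ

theorem IsFreeGenerator.isUnit_of_smul {σ : M} {a : R} (hσ : IsFreeGenerator R σ)
    (haσ : IsFreeGenerator R (a • σ)) : IsUnit a := by
  obtain ⟨b, hb : b • a • σ = σ⟩ := haσ.2 σ
  refine IsUnit.of_mul_eq_one_right b (hσ.1 ?_)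
  simpa only [mul_smul, one_smul] using hb

theorem IsFreeGenerator.unit_smul {σ : M} {a : R} (hσ : IsFreeGenerator R σ) (ha : IsUnit a) :
    IsFreeGenerator R (a • σ) := by
  have h : (fun b : R => b • a • σ) = (fun b : R => b • σ) ∘ fun b => b * a :=
    funext fun b => (mul_smul b a σ).symm
  rw [IsFreeGenerator, h]
  exact hσ.comp (ha.unit.mulRight_bijective)

theorem IsFreeGenerator.existsUnique_unit {σ σ' : M} (hσ : IsFreeGenerator R σ)
    (hσ' : IsFreeGenerator R σ') : ∃! u : Rˣ, σ = (u : R) • σ' := by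
  obtain ⟨a, rfl : a • σ' = σ⟩ := hσ'.2 σ
  obtain ⟨u, rfl⟩ := hσ'.isUnit_of_smul hσ
  exact ⟨u, rfl, fun v hv => Units.ext (hσ'.1 hv.symm)⟩

theorem IsFreeGenerator.tmul_bijective {σ : M} (hσ : IsFreeGenerator R σ) (K : Type*)
    [AddCommGroup K] [Module R K] : Function.Bijective fun κ : K => κ ⊗ₜ[R] σ := by
  let e : R ≃ₗ[R] M := LinearEquiv.ofBijective (LinearMap.toSpanSingleton R M σ) hσ
  have he : (fun κ : K => κ ⊗ₜ[R] σ) = (TensorProduct.rid R K).symm ≪≫ₗ e.lTensor K := by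
    funext κ
    exact congrArg (κ ⊗ₜ[R] ·) (one_smul R σ).symm
  rw [he]
  exact LinearEquiv.bijective _

theorem IsFreeGenerator.one_tmul {σ : M} (hσ : IsFreeGenerator R σ) (S : Type*) [CommRing S]
    [Algebra R S] : IsFreeGenerator S (1 ⊗ₜ[R] σ : S ⊗[R] M) := by
  simpa only [IsFreeGenerator, TensorProduct.smul_tmul', smul_eq_mul, mul_one] using
    hσ.tmul_bijective S

theorem IsFreeGenerator.of_one_tmul {σ e : M} {S : Type*} [CommRing S] [Algebra R S]
    [IsLocalHom (algebraMap R S)] (he : IsFreeGenerator R e)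
    (hσ : IsFreeGenerator S (1 ⊗ₜ[R] σ : S ⊗[R] M)) : IsFreeGenerator R σ := by
  obtain ⟨a, rfl : a • e = σ⟩ := he.2 σ
  rw [← TensorProduct.smul_tmul, Algebra.smul_def, ← smul_eq_mul, ← TensorProduct.smul_tmul'] at hσ
  exact he.unit_smul (IsUnit.of_map (algebraMap R S) a ((he.one_tmul S).isUnit_of_smul hσ))

end FreeGenerator

section Leibniz

variable {k R M : Type*} [CommRing k] [CommRing R] [Algebra k R] [AddCommGroup M] [Module R M]

variable (k) in
/-- The Leibniz rule for `D : M → Ω[R⁄k] ⊗ M`, that is, `D` is a connection on the module `M`.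
The maps induced by a connection on the stalks of a line bundle are of this kind. -/
def IsLeibniz (D : M →+ Ω[R⁄k] ⊗[R] M) : Prop :=
  ∀ (a : R) (m : M), D (a • m) = KaehlerDifferential.D k R a ⊗ₜ m + a • D m

theorem IsLeibniz.map_smul_of_eq_tmul {D : M →+ Ω[R⁄k] ⊗[R] M} (hD : IsLeibniz k D) {σ : M}
    {η : Ω[R⁄k]} (h : D σ = η ⊗ₜ σ) (a : R) :
    D (a • σ) = (KaehlerDifferential.D k R a + a • η) ⊗ₜ σ := by
  rw [hD, h, TensorProduct.smul_tmul', TensorProduct.add_tmul]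

theorem IsLeibniz.ext {D D' : M →+ Ω[R⁄k] ⊗[R] M} (hD : IsLeibniz k D) (hD' : IsLeibniz k D')
    {σ : M} (hσ : IsFreeGenerator R σ) (h : D σ = D' σ) : D = D' := by
  ext m
  obtain ⟨a, rfl : a • σ = m⟩ := hσ.2 m
  rw [hD, hD', h]

theorem IsFreeGenerator.exists_isLeibniz {σ : M} (hσ : IsFreeGenerator R σ)
    (t : Ω[R⁄k] ⊗[R] M) : ∃ D : M →+ Ω[R⁄k] ⊗[R] M, IsLeibniz k D ∧ D σ = t := by
  let e : R ≃ₗ[R] M := LinearEquiv.ofBijective (LinearMap.toSpanSingleton R M σ) hσ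
  have coeff_smul (m : M) : e.symm m • σ = m := e.apply_symm_apply m
  have coeff_self : e.symm σ = 1 := hσ.1 ((coeff_smul σ).trans (one_smul R σ).symm)
  let D : M →+ Ω[R⁄k] ⊗[R] M := AddMonoidHom.mk'
    (fun m => KaehlerDifferential.D k R (e.symm m) ⊗ₜ σ + e.symm m • t) fun m m' => by
      simp only [map_add, TensorProduct.add_tmul, add_smul]
      abel
  have D_apply (m : M) : D m = KaehlerDifferential.D k R (e.symm m) ⊗ₜ σ + e.symm m • t := rfl
  refine ⟨D, fun a m => ?_, ?_⟩
  · have tmul_eq : KaehlerDifferential.D k R a ⊗ₜ[R] m =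
        (e.symm m • KaehlerDifferential.D k R a) ⊗ₜ[R] σ := by
      rw [TensorProduct.smul_tmul, coeff_smul]
    rw [D_apply, D_apply, tmul_eq, map_smul, smul_eq_mul, Derivation.leibniz,
      TensorProduct.add_tmul, smul_add, TensorProduct.smul_tmul', mul_smul]
    abel
  · rw [D_apply, coeff_self, Derivation.map_one_eq_zero, TensorProduct.zero_tmul, zero_add,
      one_smul]

theorem IsLeibniz.smul_form_eq {D : M →+ Ω[R⁄k] ⊗[R] M} (hD : IsLeibniz k D) {σ : M}
    (hσ : IsFreeGenerator R σ) {a : R} {η η' : Ω[R⁄k]} (h : D σ = η ⊗ₜ σ)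
    (h' : D (a • σ) = η' ⊗ₜ (a • σ)) : a • η' = KaehlerDifferential.D k R a + a • η := by
  refine (hσ.tmul_bijective _).1 ?_
  change (a • η') ⊗ₜ[R] σ = _ ⊗ₜ[R] σ
  rw [TensorProduct.smul_tmul, ← h', hD.map_smul_of_eq_tmul h]

variable {S : Type*} [CommRing S] [Algebra k S] [Algebra R S] [IsScalarTower k R S]

theorem IsLeibniz.exists_baseChange {D : M →+ Ω[R⁄k] ⊗[R] M} (hD : IsLeibniz k D) {σ : M}
    (hσ : IsFreeGenerator R σ) : ∃ D' : S ⊗[R] M →+ Ω[S⁄k] ⊗[S] (S ⊗[R] M), IsLeibniz k D' ∧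
      ∀ m η, D m = η ⊗ₜ m → D' (1 ⊗ₜ m) = KaehlerDifferential.map k k R S η ⊗ₜ (1 ⊗ₜ m) := by
  let q := KaehlerDifferential.map k k R S
  obtain ⟨η₀, h₀ : η₀ ⊗ₜ σ = D σ⟩ := (hσ.tmul_bijective _).2 (D σ)
  obtain ⟨D', hD', h₀'⟩ :=
    (hσ.one_tmul S).exists_isLeibniz (k := k) (q η₀ ⊗ₜ[S] (1 ⊗ₜ[R] σ))
  refine ⟨D', hD', fun m η hη => ?_⟩
  obtain ⟨a, rfl : a • σ = m⟩ := hσ.2 m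
  have gauge : a • η = KaehlerDifferential.D k R a + a • η₀ := hD.smul_form_eq hσ h₀.symm hη
  have tmul_smul : (1 : S) ⊗ₜ[R] (a • σ) = algebraMap R S a • (1 ⊗ₜ[R] σ) := by
    rw [TensorProduct.tmul_smul, algebraMap_smul]
  calc D' (1 ⊗ₜ (a • σ))
      = (KaehlerDifferential.D k S (algebraMap R S a) + algebraMap R S a • q η₀) ⊗ₜ
          (1 ⊗ₜ σ) := by rw [tmul_smul, hD'.map_smul_of_eq_tmul h₀']
    _ = (algebraMap R S a • q η) ⊗ₜ (1 ⊗ₜ σ) := by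
        rw [algebraMap_smul, algebraMap_smul, ← map_smul q, ← map_smul q, gauge, map_add,
          KaehlerDifferential.map_D]
    _ = q η ⊗ₜ (1 ⊗ₜ (a • σ)) := by rw [tmul_smul, TensorProduct.smul_tmul]

end Leibniz

variable {X Y : Type} [TopologicalSpace X] [TopologicalSpace Y]

/-! ### Line bundles -/

section LineBundle

theorem exists_of_locally_exists_unique {F : X → Type} {S : ∀ U : Opens X, Set (∀ x : U, F x)}
    {U : Opens X}
    (glue : ∀ s : ∀ x : U, F x,
      (∀ x : U, ∃ (V : Opens X) (h : V ≤ U), x.1 ∈ V ∧ restr h s ∈ S V) → s ∈ S U)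
    {P : ∀ x : U, F x → Prop} (unique : ∀ x a b, P x a → P x b → a = b)
    (exists_local : ∀ x : U, ∃ (V : Opens X) (h : V ≤ U), x.1 ∈ V ∧
      ∃ s ∈ S V, ∀ z : V, P ⟨z.1, h z.2⟩ (s z)) :
    ∃ s ∈ S U, ∀ x, P x (s x) := by
  choose V h mem s hs hP using exists_local
  have hP' (x : U) : P x (s x ⟨x.1, mem x⟩) := hP x ⟨x.1, mem x⟩
  refine ⟨fun x => s x ⟨x.1, mem x⟩, glue _ fun x => ⟨V x, h x, mem x, ?_⟩, hP'⟩
  have restr_eq : restr (h x) (fun x => s x ⟨x.1, mem x⟩) = s x :=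
    funext fun z => unique ⟨z.1, h x z.2⟩ _ _ (hP' _) (hP x z)
  exact restr_eq ▸ hs x

/-- `σ` trivializes `M` over `U`: multiplication by `σ` is an isomorphism `A|_U → M|_U`, on stalks
and on sections. The second condition does not follow from `IsFrame`, because the elements of the
stalks need not be germs of sections. -/
structure IsBasis {A : AlgSheaf X} (M : ModSheaf A) {U : Opens X} (σ : M.sec U) : Prop where
  isFrame : IsFrame M σ
  exists_coeff : ∀ {V : Opens X} (h : V ≤ U) (s : M.sec V),
    ∃ a : A.sec V, ∀ x : V, a.1 x • σ.1 ⟨x.1, h x.2⟩ = s.1 x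

/-- `M` is a line bundle, that is, locally free of rank one. -/
def IsLineBundle {A : AlgSheaf X} (M : ModSheaf A) : Prop :=
  ∀ x : X, ∃ U : Opens X, x ∈ U ∧ ∃ e : M.sec U, IsBasis M e

/-- A section of `A` with invertible germ at `x` is invertible near `x`. -/
def AlgSheaf.HasOpenUnits (A : AlgSheaf X) : Prop :=
  ∀ ⦃U : Opens X⦄ (a : A.sec U) (x : U), IsUnit (a.1 x) →
    ∃ (V : Opens X) (h : V ≤ U), x.1 ∈ V ∧ IsUnit (A.res h a)

variable {A : AlgSheaf X} {M : ModSheaf A} {U : Opens X}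

theorem IsFrame.isBasis {σ : M.sec U} (hσ : IsFrame M σ)
    (exists_local_coeff : ∀ {V : Opens X} (h : V ≤ U) (s : M.sec V) (x : V),
      ∃ (W : Opens X) (h' : W ≤ V), x.1 ∈ W ∧
        ∃ a : A.sec W, ∀ z : W, a.1 z • σ.1 ⟨z.1, h (h' z.2)⟩ = s.1 ⟨z.1, h' z.2⟩) :
    IsBasis M σ where
  isFrame := hσ
  exists_coeff {V} h s := by
    obtain ⟨a, ha, hs⟩ := exists_of_locally_exists_unique (S := fun V => A.sec V)
      (P := fun x : V => fun a : A.Stalk x => a • σ.1 ⟨x.1, h x.2⟩ = s.1 x) (A.glue_mem V)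
      (fun x _ _ ha hb => (hσ ⟨x.1, h x.2⟩).1 (ha.trans hb.symm)) fun x => by
        obtain ⟨W, h', hx, a, ha⟩ := exists_local_coeff h s x
        exact ⟨W, h', hx, a.1, a.2, ha⟩
    exact ⟨⟨a, ha⟩, hs⟩

theorem IsBasis.res {σ : M.sec U} (hσ : IsBasis M σ) {V : Opens X} (h : V ≤ U) :
    IsBasis M (M.res h σ) where
  isFrame x := hσ.isFrame ⟨x.1, h x.2⟩
  exists_coeff h' s := hσ.exists_coeff (h'.trans h) s

theorem IsBasis.unit_smul {σ : M.sec U} (hσ : IsBasis M σ) (u : (A.sec U)ˣ) :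
    IsBasis M ((u : A.sec U) • σ) where
  isFrame x := (show IsFreeGenerator _ _ from hσ.isFrame x).unit_smul
    (u.isUnit.map ((Pi.evalRingHom _ x).comp (A.sec U).val.toRingHom))
  exists_coeff {V} h s := by
    obtain ⟨a, ha⟩ := hσ.exists_coeff h s
    refine ⟨a * A.res h (↑u⁻¹ : A.sec U), fun x => ?_⟩
    let z : U := ⟨x.1, h x.2⟩
    have inv_mul : (↑u⁻¹ : A.sec U).1 z * (u : A.sec U).1 z = 1 :=
      congrFun (congrArg Subtype.val u.inv_mul) z
    change (a.1 x * (↑u⁻¹ : A.sec U).1 z) • (u : A.sec U).1 z • σ.1 z = s.1 x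
    rw [← ha x, smul_smul, mul_assoc, inv_mul, mul_one]

theorem IsBasis.isFreeGenerator {σ : M.sec U} (hσ : IsBasis M σ) : IsFreeGenerator (A.sec U) σ :=
  ⟨fun _ _ h => Subtype.ext (funext fun x =>
      (hσ.isFrame x).1 (congrFun (congrArg Subtype.val h) x)),
    fun s => (hσ.exists_coeff le_rfl s).imp fun _ ha => Subtype.ext (funext ha)⟩

theorem IsLineBundle.exists_isFreeGenerator (hM : IsLineBundle M) (x : X) :
    ∃ e : M.Stalk x, IsFreeGenerator (A.Stalk x) e := by
  obtain ⟨U, hx, e, he⟩ := hM x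
  exact ⟨e.1 ⟨x, hx⟩, he.isFrame ⟨x, hx⟩⟩

theorem IsLineBundle.exists_isBasis_res (hM : IsLineBundle M) (hA : A.HasOpenUnits)
    {s : M.sec U} {x : U} (hs : IsFreeGenerator (A.Stalk x) (s.1 x)) :
    ∃ (V : Opens X) (h : V ≤ U), x.1 ∈ V ∧ IsBasis M (M.res h s) := by
  obtain ⟨W, hx, e, he⟩ := hM x
  obtain ⟨a, ha⟩ := he.exists_coeff (inf_le_right : U ⊓ W ≤ W) (M.res inf_le_left s)
  obtain ⟨V, h, hxV, u, hu⟩ := hA a ⟨x.1, x.2, hx⟩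
    (IsFreeGenerator.isUnit_of_smul (he.isFrame ⟨x.1, hx⟩) ((ha ⟨x.1, x.2, hx⟩).symm ▸ hs))
  have res_eq : M.res (h.trans inf_le_left) s = (u : A.sec V) • M.res (h.trans inf_le_right) e :=
    Subtype.ext (funext fun z => (ha ⟨z.1, h z.2⟩).symm.trans
      (congrArg (fun b : A.sec V => (b • M.res (h.trans inf_le_right) e).1 z) hu.symm))
  exact ⟨V, h.trans inf_le_left, hxV, res_eq ▸ (he.res _).unit_smul u⟩

theorem IsBasis.exists_theta_eq {σ : M.sec U} (hσ : IsBasis M σ) {K : ModSheaf A}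
    (β : (tensor K M).sec U) : ∃ α : K.sec U, theta K M U (α ⊗ₜ σ) = β := by
  obtain ⟨α, hα, h⟩ := exists_of_locally_exists_unique (S := fun V => K.sec V)
    (P := fun x : U => fun κ : K.Stalk x => κ ⊗ₜ[A.Stalk x] σ.1 x = β.1 x) (K.glue_mem U)
    (fun x _ _ ha hb => (IsFreeGenerator.tmul_bijective (hσ.isFrame x) _).1 (ha.trans hb.symm))
    fun x => by
      obtain ⟨V, h, hx, hβ⟩ := β.2 x
      let tmulRes : K.sec V →ₗ[A.sec V] ∀ z : V, K.Stalk z ⊗[A.Stalk z] M.Stalk z :=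
        (Submodule.subtype _).comp
          ((theta K M V).comp ((TensorProduct.mk _ _ _).flip (M.res h σ)))
      have span_le : Submodule.span (A.sec V) {w | ∃ (m : K.sec V) (n : M.sec V),
          w = fun x : V => m.1 x ⊗ₜ n.1 x} ≤ LinearMap.range tmulRes := by
        rw [Submodule.span_le]
        rintro _ ⟨m, n, rfl⟩
        obtain ⟨a, ha⟩ := hσ.exists_coeff h n
        refine ⟨a • m, funext fun z => ?_⟩
        rw [← ha z, ← TensorProduct.smul_tmul]
        rfl
      obtain ⟨α, hα⟩ := span_le hβ
      exact ⟨V, h, hx, α.1, α.2, congrFun hα⟩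
  exact ⟨⟨α, hα⟩, Subtype.ext (funext h)⟩

theorem IsFrame.theta_tmul_injective {σ : M.sec U} (hσ : IsFrame M σ) (K : ModSheaf A) :
    Function.Injective fun α : K.sec U => theta K M U (α ⊗ₜ σ) := fun _ _ h =>
  Subtype.ext (funext fun x => (IsFreeGenerator.tmul_bijective (hσ x) _).1
    (congrFun (congrArg Subtype.val h) x))

end LineBundle

/-! ### Connections on line bundles -/

section Connection

variable {A : AlgSheaf X} {M : ModSheaf A}

/-- The connection `nab` is given on the stalks by the maps `D x`. -/
def Connection.HasStalks (nab : Connection M)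
    (D : ∀ x, M.Stalk x →+ Ω[A.Stalk x⁄ℂ] ⊗[A.Stalk x] M.Stalk x) : Prop :=
  ∀ (U : Opens X) (s : M.sec U) (x : U), (nab.app U s).1 x = D x (s.1 x)

theorem IsLineBundle.exists_hasStalks (hM : IsLineBundle M) (nab : Connection M) :
    ∃ D : ∀ x, M.Stalk x →+ Ω[A.Stalk x⁄ℂ] ⊗[A.Stalk x] M.Stalk x,
      (∀ x, IsLeibniz ℂ (D x)) ∧ nab.HasStalks D := by
  choose W mem e he using hM
  choose D hD hDe using fun x =>
    IsFreeGenerator.exists_isLeibniz (k := ℂ) ((he x).isFrame ⟨x, mem x⟩)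
      ((nab.app (W x) (e x)).1 ⟨x, mem x⟩)
  refine ⟨D, hD, fun U s x => ?_⟩
  let V : Opens X := U ⊓ W x
  let z : V := ⟨x.1, x.2, mem x⟩
  obtain ⟨a, ha⟩ := (he x).exists_coeff (inf_le_right : V ≤ W x) (M.res inf_le_left s)
  let e' : M.sec V := M.res inf_le_right (e x)
  have res_eq : M.res inf_le_left s = a • e' := Subtype.ext (funext fun z => (ha z).symm)
  have leibniz : nab.app V (M.res inf_le_left s) =
      theta (kaehler A) M V (dif a ⊗ₜ e') + a • nab.app V e' := by rw [res_eq, nab.leibniz]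
  have coeff_smul : a.1 z • (e x).1 ⟨x.1, mem x⟩ = s.1 x := ha z
  rw [nab.naturality, nab.naturality] at leibniz
  rw [← coeff_smul, hD, hDe]
  exact congrFun (congrArg Subtype.val leibniz) z

theorem exists_connection_hasStalks
    {D : ∀ x, M.Stalk x →+ Ω[A.Stalk x⁄ℂ] ⊗[A.Stalk x] M.Stalk x} (hD : ∀ x, IsLeibniz ℂ (D x))
    (exists_form : ∀ x, ∃ U : Opens X, x ∈ U ∧ ∃ e : M.sec U, IsBasis M e ∧
      ∃ α : (kaehler A).sec U, ∀ z : U, D z (e.1 z) = α.1 z ⊗ₜ e.1 z) :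
    ∃ nab : Connection M, nab.HasStalks D := by
  have mem (U : Opens X) (s : M.sec U) :
      (fun x : U => D x (s.1 x)) ∈ (tensor (kaehler A) M).sec U := by
    refine (tensor (kaehler A) M).glue_mem U _ fun x => ?_
    obtain ⟨W, hx, e, he, α, hα⟩ := exists_form x
    obtain ⟨a, ha⟩ := he.exists_coeff (inf_le_right : U ⊓ W ≤ W) (M.res inf_le_left s)
    refine ⟨U ⊓ W, inf_le_left, ⟨x.2, hx⟩, ModSheaf.mem_of_eq _ (funext fun z => ?_)
      (theta (kaehler A) M (U ⊓ W) ((dif a + a • (kaehler A).res inf_le_right α) ⊗ₜ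
        M.res inf_le_right e)).2⟩
    exact (congrArg (D z) (ha z).symm).trans ((hD z).map_smul_of_eq_tmul (hα ⟨z.1, z.2.2⟩) (a.1 z))
  exact ⟨{
    app := fun U => AddMonoidHom.mk' (fun s => ⟨_, mem U s⟩) fun s t =>
      Subtype.ext (funext fun x => map_add (D x) (s.1 x) (t.1 x))
    naturality := fun _ _ => rfl
    leibniz := fun U g s => Subtype.ext (funext fun x => hD x (g.1 x) (s.1 x)) }, fun _ _ _ => rfl⟩

theorem Connection.smul_form_eq (hM : IsLineBundle M) (nab : Connection M) {U : Opens X}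
    {σ : M.sec U} (hσ : IsFrame M σ) {b : A.sec U} {α α' : (kaehler A).sec U}
    (h : nab.app U σ = theta (kaehler A) M U (α ⊗ₜ σ))
    (h' : nab.app U (b • σ) = theta (kaehler A) M U (α' ⊗ₜ (b • σ))) :
    b • α' = dif b + b • α := by
  obtain ⟨D, hD, hnab⟩ := hM.exists_hasStalks nab
  exact Subtype.ext (funext fun x => (hD x).smul_form_eq (hσ x)
    ((hnab U σ x).symm.trans (congrFun (congrArg Subtype.val h) x))
    ((hnab U (b • σ) x).symm.trans (congrFun (congrArg Subtype.val h') x)))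

theorem Connection.ext_of_isFrame (hM : IsLineBundle M) {nab nab' : Connection M}
    (h : ∀ x, ∃ U : Opens X, x ∈ U ∧ ∃ σ : M.sec U, IsFrame M σ ∧ nab.app U σ = nab'.app U σ) :
    nab = nab' := by
  obtain ⟨D, hD, hnab⟩ := hM.exists_hasStalks nab
  obtain ⟨D', hD', hnab'⟩ := hM.exists_hasStalks nab'
  have D_eq (x : X) : D x = D' x := by
    obtain ⟨U, hx, σ, hσ, e⟩ := h x
    refine (hD x).ext (hD' x) (hσ ⟨x, hx⟩) ?_
    rw [← hnab U σ ⟨x, hx⟩, ← hnab' U σ ⟨x, hx⟩, e]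
  refine Connection.ext (funext fun U => AddMonoidHom.ext fun s => Subtype.ext (funext fun x => ?_))
  rw [hnab, hnab', D_eq]

end Connection

/-! ### Inverse images -/

section InverseImage

variable {A : AlgSheaf X} {M : ModSheaf A}

/-- The section of `j⁻¹A` over `j⁻¹W` induced by a section of `A` over `W`. -/
def AlgSheaf.pullback (j : C(Y, X)) {W : Opens X} (a : A.sec W) :
    (A.inverseImage j).sec (Opens.comap j W) :=
  ⟨fun y => a.1 ⟨j y.1, y.2⟩, fun y => ⟨Opens.comap j W, W, a, y.2, fun z _ => ⟨z.2, rfl⟩⟩⟩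

/-- The section of `j⁻¹M` over `j⁻¹W` induced by a section of `M` over `W`. -/
def ModSheaf.pullback (j : C(Y, X)) {W : Opens X} (s : M.sec W) :
    (M.inverseImage j).sec (Opens.comap j W) :=
  ⟨fun y => s.1 ⟨j y.1, y.2⟩, fun y => ⟨Opens.comap j W, W, s, y.2, fun z _ => ⟨z.2, rfl⟩⟩⟩

theorem exists_pullback_form (j : C(Y, X)) {W : Opens X} (α : (kaehler A).sec W) :
    ∃ αt : (kaehler (A.inverseImage j)).sec (Opens.comap j W), ∀ y, αt.1 y = α.1 ⟨j y.1, y.2⟩ := by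
  refine ⟨⟨fun y => α.1 ⟨j y.1, y.2⟩, fun y => ?_⟩, fun y => rfl⟩
  obtain ⟨V, h, hy, hα⟩ := α.2 ⟨j y.1, y.2⟩
  refine ⟨Opens.comap j V, fun z hz => h hz, hy, ?_⟩
  have pullback_mem_span (η : ∀ x : V, Ω[A.Stalk x⁄ℂ]) (hη : η ∈ Submodule.span (A.sec V)
      {η | ∃ b : A.sec V, η = fun x : V => KaehlerDifferential.D ℂ (A.Stalk x) (b.1 x)}) :
      (fun z : Opens.comap j V => η ⟨j z.1, z.2⟩) ∈
        Submodule.span ((A.inverseImage j).sec (Opens.comap j V))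
          {η | ∃ b : (A.inverseImage j).sec (Opens.comap j V), η = fun z : Opens.comap j V =>
            KaehlerDifferential.D ℂ ((A.inverseImage j).Stalk z) (b.1 z)} := by
    induction hη using Submodule.span_induction with
    | mem η hη =>
      obtain ⟨b, rfl⟩ := hη
      exact Submodule.subset_span ⟨AlgSheaf.pullback j b, rfl⟩
    | zero => exact Submodule.zero_mem _
    | add η η' _ _ hη hη' => exact Submodule.add_mem _ hη hη'
    | smul a η _ hη => exact Submodule.smul_mem _ (AlgSheaf.pullback j a) hη
  exact pullback_mem_span _ hα

theorem isBasis_of_induced_by_isBasis {j : C(Y, X)} {U : Opens Y} {σ : (M.inverseImage j).sec U}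
    (h : ∀ y : U, ∃ (W : Opens X) (t : M.sec W), j y ∈ W ∧ IsBasis M t ∧
      ∀ (z : U) (hz : j z ∈ W), σ.1 z = t.1 ⟨j z, hz⟩) :
    IsBasis (M.inverseImage j) σ := by
  have hσ : IsFrame (M.inverseImage j) σ := fun y => by
    obtain ⟨W, t, hy, ht, e⟩ := h y
    rw [e y hy]
    exact ht.isFrame ⟨j y, hy⟩
  refine hσ.isBasis fun {V} hV s y => ?_
  obtain ⟨W, t, hy, ht, e⟩ := h ⟨y.1, hV y.2⟩
  obtain ⟨V', W', t', hyV', e'⟩ := s.2 y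
  have hyW' : j y ∈ W' := (e' y hyV').1
  obtain ⟨a, ha⟩ := ht.exists_coeff (inf_le_right : W' ⊓ W ≤ W) (M.res inf_le_left t')
  let V'' : Opens Y := V ⊓ V' ⊓ Opens.comap j (W' ⊓ W)
  refine ⟨V'', inf_le_left.trans inf_le_left, ⟨⟨y.2, hyV'⟩, hyW', hy⟩,
    (A.inverseImage j).res inf_le_right (AlgSheaf.pullback j a), fun z => ?_⟩
  obtain ⟨_, s_eq⟩ := e' ⟨z.1, z.2.1.1⟩ z.2.1.2
  rw [e ⟨z.1, hV z.2.1.1⟩ z.2.2.2, s_eq]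
  exact ha ⟨j z, z.2.2⟩

theorem IsBasis.pullback {W : Opens X} {t : M.sec W} (ht : IsBasis M t) (j : C(Y, X)) :
    IsBasis (M.inverseImage j) (ModSheaf.pullback j t) :=
  isBasis_of_induced_by_isBasis fun y => ⟨W, t, y.2, ht, fun _ _ => rfl⟩

theorem IsLineBundle.inverseImage (hM : IsLineBundle M) (j : C(Y, X)) :
    IsLineBundle (M.inverseImage j) := fun y => by
  obtain ⟨W, hy, e, he⟩ := hM (j y)
  exact ⟨Opens.comap j W, hy, ModSheaf.pullback j e, he.pullback j⟩

theorem IsFrame.exists_isBasis_inducing {j : C(Y, X)} (hj : IsInducing j) (hM : IsLineBundle M)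
    (hA : A.HasOpenUnits) {U : Opens Y} {σ : (M.inverseImage j).sec U}
    (hσ : IsFrame (M.inverseImage j) σ) (y : U) :
    ∃ (W : Opens X) (t : M.sec W), j y ∈ W ∧ IsBasis M t ∧
      ∀ (z : U) (hz : j z ∈ W), σ.1 z = t.1 ⟨j z, hz⟩ := by
  obtain ⟨⟨V, hV⟩, W, t, hyV, e⟩ := σ.2 y
  obtain ⟨hyW, σ_eq⟩ := e y hyV
  have t_gen : IsFreeGenerator (A.Stalk (j y)) (t.1 ⟨j y, hyW⟩) := by
    rw [← σ_eq]
    exact hσ y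
  obtain ⟨W', h', hyW', ht⟩ := hM.exists_isBasis_res hA (x := ⟨j y, hyW⟩) t_gen
  obtain ⟨T, hT, rfl⟩ := hj.isOpen_iff.mp hV
  exact ⟨W' ⊓ ⟨T, hT⟩, M.res (inf_le_left.trans h') t, ⟨hyW', hyV⟩, ht.res inf_le_left,
    fun z hz => (e z hz.2).2⟩

/-- `nab'` is the inverse image `j⁻¹∇` of the connection `∇`: if `s` has the same germ at `y` as
the section induced by `t`, then `nab' s` has the same germ at `y` as the section induced by
`∇t`. -/
def Connection.IsInverseImage {j : C(Y, X)} (nab : Connection M)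
    (nab' : Connection (M.inverseImage j)) : Prop :=
  ∀ ⦃U : Opens Y⦄ (s : (M.inverseImage j).sec U) (y : U) ⦃W : Opens X⦄ (t : M.sec W) (hy : j y ∈ W),
    s.1 y = t.1 ⟨j y, hy⟩ → (nab'.app U s).1 y = (nab.app W t).1 ⟨j y, hy⟩

theorem Connection.exists_isInverseImage (hM : IsLineBundle M) (nab : Connection M) (j : C(Y, X)) :
    ∃ nab' : Connection (M.inverseImage j), nab.IsInverseImage nab' := by
  obtain ⟨D, hD, hnab⟩ := hM.exists_hasStalks nab
  obtain ⟨nab', hnab'⟩ := exists_connection_hasStalks (M := M.inverseImage j)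
    (D := fun y => D (j y)) (fun y => hD (j y)) fun y => by
      obtain ⟨W, hy, e, he⟩ := hM (j y)
      obtain ⟨α, hα⟩ := he.exists_theta_eq (nab.app W e)
      obtain ⟨αt, hαt⟩ := exists_pullback_form j α
      refine ⟨Opens.comap j W, hy, ModSheaf.pullback j e, he.pullback j, αt, fun z => ?_⟩
      rw [hαt]
      exact (hnab W e ⟨j z, z.2⟩).symm.trans (congrFun (congrArg Subtype.val hα) _).symm
  refine ⟨nab', fun U s y W t hy e => ?_⟩
  rw [hnab', e]
  exact (hnab W t ⟨j y, hy⟩).symm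

end InverseImage

/-! ### Base change -/

section BaseChange

variable {A B : AlgSheaf X} {M : ModSheaf A} {U : Opens X}

theorem IsBasis.oneTmul {σ : M.sec U} (hσ : IsBasis M σ) (f : A.Hom B) :
    IsBasis (baseChange f M) (GermSheaf.oneTmul f σ) := by
  have isFrame : IsFrame (baseChange f M) (GermSheaf.oneTmul f σ) := fun x =>
    letI := f.algebra x
    IsFreeGenerator.one_tmul (hσ.isFrame x) (B.Stalk x)
  refine isFrame.isBasis fun {V} h s x => ?_
  obtain ⟨W, h', hx, hs⟩ := s.2 x
  let τ : ∀ z : W, BaseChangeStalk f M z :=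
    restr (h'.trans h) fun z => baseChangeTmul f M z 1 (σ.1 z)
  have span_le : Submodule.span (B.sec W) {w | ∃ (b : B.sec W) (m : M.sec W),
      w = fun z : W => baseChangeTmul f M z (b.1 z) (m.1 z)} ≤ Submodule.span (B.sec W) {τ} := by
    rw [Submodule.span_le]
    rintro _ ⟨b, m, rfl⟩
    obtain ⟨a, ha⟩ := hσ.exists_coeff (h'.trans h) m
    refine Submodule.mem_span_singleton.mpr ⟨b * f.app a, funext fun z => ?_⟩
    let := f.algebra z
    change (b.1 z * f.stalk z (a.1 z)) • baseChangeTmul f M z 1 _ = b.1 z ⊗ₜ[A.Stalk z] m.1 z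
    rw [mul_smul, ← baseChangeTmul_smul, ha z]
    exact (TensorProduct.smul_tmul' _ _ _).trans (congrArg (· ⊗ₜ m.1 z) (mul_one (b.1 z)))
  obtain ⟨b, hb⟩ := Submodule.mem_span_singleton.mp (span_le hs)
  exact ⟨W, h', hx, b, congrFun hb⟩

theorem IsLineBundle.baseChange (hM : IsLineBundle M) (f : A.Hom B) :
    IsLineBundle (GermSheaf.baseChange f M) := fun x => by
  obtain ⟨U, hx, e, he⟩ := hM x
  exact ⟨U, hx, oneTmul f e, he.oneTmul f⟩

theorem isFrame_of_isFrame_oneTmul (hM : IsLineBundle M) {f : A.Hom B}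
    (hf : ∀ x, IsLocalHom (f.stalk x)) {σ : M.sec U}
    (hσ : IsFrame (GermSheaf.baseChange f M) (oneTmul f σ)) : IsFrame M σ := fun x => by
  obtain ⟨e, he⟩ := hM.exists_isFreeGenerator x
  let := f.algebra x
  have : IsLocalHom (algebraMap (A.Stalk x) (B.Stalk x)) := ⟨(hf x).map_nonunit⟩
  exact he.of_one_tmul (hσ x)

theorem Connection.exists_baseChange (hM : IsLineBundle M) (nab : Connection M) (f : A.Hom B) :
    ∃ nab' : Connection (baseChange f M), ∀ {U : Opens X} (s : M.sec U) (α : (kaehler A).sec U),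
      nab.app U s = theta (kaehler A) M U (α ⊗ₜ s) →
        nab'.app U (oneTmul f s) = theta (kaehler B) (baseChange f M) U
          (conormal f U (oneTmul f α) ⊗ₜ oneTmul f s) := by
  obtain ⟨D, hD, hnab⟩ := hM.exists_hasStalks nab
  have exists_stalk (x : X) : ∃ D' : BaseChangeStalk f M x →+
      Ω[B.Stalk x⁄ℂ] ⊗[B.Stalk x] BaseChangeStalk f M x, IsLeibniz ℂ D' ∧
      ∀ m η, D x m = η ⊗ₜ m → D' (baseChangeTmul f M x 1 m) =
        conormalStalk f x (baseChangeTmul f (kaehler A) x 1 η) ⊗ₜ baseChangeTmul f M x 1 m := by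
    let := f.algebra x
    have := f.isScalarTower x
    obtain ⟨e, he⟩ := hM.exists_isFreeGenerator x
    obtain ⟨D', hD', h⟩ := (hD x).exists_baseChange (S := B.Stalk x) he
    refine ⟨D', hD', fun m η hη => (h m η hη).trans ?_⟩
    refine congrArg (· ⊗ₜ _) (Eq.symm ?_)
    exact (KaehlerDifferential.mapBaseChange_tmul ℂ (A.Stalk x) (B.Stalk x) 1 η).trans
      (one_smul _ _)
  choose D' hD' h using exists_stalk
  have stalk_eq {U : Opens X} {s : M.sec U} {α : (kaehler A).sec U}
      (hα : nab.app U s = theta (kaehler A) M U (α ⊗ₜ s)) (x : U) :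
      D' x ((oneTmul f s).1 x) = (conormal f U (oneTmul f α)).1 x ⊗ₜ (oneTmul f s).1 x :=
    h x (s.1 x) (α.1 x) ((hnab U s x).symm.trans (congrFun (congrArg Subtype.val hα) x))
  obtain ⟨nab', hnab'⟩ := exists_connection_hasStalks (M := baseChange f M) hD' fun x => by
    obtain ⟨U, hx, e, he⟩ := hM x
    obtain ⟨α, hα⟩ := he.exists_theta_eq (nab.app U e)
    exact ⟨U, hx, oneTmul f e, he.oneTmul f, conormal f U (oneTmul f α), stalk_eq hα.symm⟩
  exact ⟨nab', fun {U} s α hα => Subtype.ext (funext fun x => (hnab' U _ x).trans (stalk_eq hα x))⟩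

end BaseChange

/-! ### Connection forms and induced connections -/

section InducedConnection

variable {A : AlgSheaf X} {M : ModSheaf A} {j : C(Y, X)}

/-- `αt` is the connection form of `∇` in the section `σt` of `j⁻¹M`: locally both are induced by
sections `σW` and `αW` over open subsets of `X` with `∇σW = αW ⊗ σW`. -/
def Connection.IsFormAlong (nab : Connection M) {U : Opens Y} (σt : (M.inverseImage j).sec U)
    (αt : (kaehler (A.inverseImage j)).sec U) : Prop :=
  ∀ y : U, ∃ (W : Opens X) (σW : M.sec W) (αW : (kaehler A).sec W),
    j y ∈ W ∧ nab.app W σW = theta (kaehler A) M W (αW ⊗ₜ σW) ∧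
      ∀ (z : U) (hz : j z ∈ W), σt.1 z = σW.1 ⟨j z, hz⟩ ∧ αt.1 z = αW.1 ⟨j z, hz⟩

theorem Connection.IsFormAlong.app_eq {nab : Connection M} {U : Opens Y}
    {σt : (M.inverseImage j).sec U} {αt : (kaehler (A.inverseImage j)).sec U}
    (h : nab.IsFormAlong σt αt) {nab' : Connection (M.inverseImage j)}
    (hnab' : nab.IsInverseImage nab') :
    nab'.app U σt = theta (kaehler (A.inverseImage j)) (M.inverseImage j) U (αt ⊗ₜ σt) := by
  refine Subtype.ext (funext fun y => ?_)
  obtain ⟨W, σW, αW, hy, hαW, e⟩ := h y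
  obtain ⟨σ_eq, α_eq⟩ := e y hy
  rw [hnab' σt y σW hy σ_eq, hαW]
  exact congrArg₂ (fun (η : Ω[A.Stalk (j y)⁄ℂ]) m => η ⊗ₜ[A.Stalk (j y)] m) α_eq.symm σ_eq.symm

variable (hj : IsInducing j) (hM : IsLineBundle M) (hA : A.HasOpenUnits)

include hj hM hA in
theorem IsFrame.isFormAlong_of_app_eq {nab : Connection M} {U : Opens Y}
    {σt : (M.inverseImage j).sec U} {αt : (kaehler (A.inverseImage j)).sec U}
    (hσt : IsFrame (M.inverseImage j) σt) {nab' : Connection (M.inverseImage j)}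
    (hnab' : nab.IsInverseImage nab')
    (h : nab'.app U σt = theta (kaehler (A.inverseImage j)) (M.inverseImage j) U (αt ⊗ₜ σt)) :
    nab.IsFormAlong σt αt := fun y => by
  obtain ⟨W, t, hy, ht, e⟩ := hσt.exists_isBasis_inducing hj hM hA y
  obtain ⟨αW, hαW⟩ := ht.exists_theta_eq (nab.app W t)
  refine ⟨W, t, αW, hy, hαW.symm, fun z hz => ⟨e z hz, ?_⟩⟩
  refine (IsFreeGenerator.tmul_bijective (ht.isFrame ⟨j z, hz⟩) Ω[A.Stalk (j z)⁄ℂ]).1 ?_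
  have nab_eq := hnab' σt z t hz (e z hz)
  rw [h, ← hαW] at nab_eq
  let η : Ω[A.Stalk (j z)⁄ℂ] := αt.1 z
  exact (congrArg (fun m : M.Stalk (j z) => η ⊗ₜ[A.Stalk (j z)] m) (e z hz)).symm.trans nab_eq

include hj hM hA in
theorem IsFrame.existsUnique_isFormAlong {U : Opens Y} {σt : (M.inverseImage j).sec U}
    (hσt : IsFrame (M.inverseImage j) σt) (nab : Connection M) :
    ∃! αt : (kaehler (A.inverseImage j)).sec U, nab.IsFormAlong σt αt := by
  obtain ⟨nab', hnab'⟩ := nab.exists_isInverseImage hM j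
  have isBasis : IsBasis (M.inverseImage j) σt :=
    isBasis_of_induced_by_isBasis (hσt.exists_isBasis_inducing hj hM hA)
  obtain ⟨αt, hαt⟩ := isBasis.exists_theta_eq (nab'.app U σt)
  exact ⟨αt, hσt.isFormAlong_of_app_eq hj hM hA hnab' hαt.symm, fun α hα =>
    hσt.theta_tmul_injective _ ((hα.app_eq hnab').symm.trans hαt.symm)⟩

variable {B : AlgSheaf Y} (f : (A.inverseImage j).Hom B)

include hM in
theorem Connection.exists_induced (nab : Connection M) :
    ∃ nabla : Connection (baseChange f (M.inverseImage j)), ∀ (U : Opens Y)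
      (σt : (M.inverseImage j).sec U) (αt : (kaehler (A.inverseImage j)).sec U),
      nab.IsFormAlong σt αt → nabla.app U (oneTmul f σt) =
        theta (kaehler B) (baseChange f (M.inverseImage j)) U
          (conormal f U (oneTmul f αt) ⊗ₜ oneTmul f σt) := by
  obtain ⟨nab', hnab'⟩ := nab.exists_isInverseImage hM j
  obtain ⟨nabla, hnabla⟩ := nab'.exists_baseChange (hM.inverseImage j) f
  exact ⟨nabla, fun U σt αt h => hnabla σt αt (h.app_eq hnab')⟩

include hM in
theorem Connection.IsFormAlong.gauge {nab : Connection M} {U : Opens Y}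
    {σt σt' : (M.inverseImage j).sec U} {αt αt' : (kaehler (A.inverseImage j)).sec U}
    (h : nab.IsFormAlong σt αt) (h' : nab.IsFormAlong σt' αt')
    (hσt' : IsFrame (baseChange f (M.inverseImage j)) (oneTmul f σt')) (b : (B.sec U)ˣ)
    (hb : oneTmul f σt = (b : B.sec U) • oneTmul f σt') :
    conormal f U (oneTmul f αt) = conormal f U (oneTmul f αt') +
      ((b⁻¹ : (B.sec U)ˣ) : B.sec U) • dif (b : B.sec U) := by
  obtain ⟨nabla, hnabla⟩ := nab.exists_induced hM f
  have app_eq := hnabla U σt αt h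
  rw [hb] at app_eq
  have smul_eq := nabla.smul_form_eq ((hM.inverseImage j).baseChange f) hσt'
    (hnabla U σt' αt' h') app_eq
  rw [← one_smul (B.sec U) (conormal f U (oneTmul f αt)), ← b.inv_mul, mul_smul, smul_eq,
    smul_add, ← mul_smul, b.inv_mul, one_smul, add_comm]

include hj hM hA in
theorem existsUnique_unit_oneTmul (hf : ∀ y, IsLocalHom (f.stalk y)) {U : Opens Y}
    {σt σt' : (M.inverseImage j).sec U}
    (hσ : IsFrame (baseChange f (M.inverseImage j)) (oneTmul f σt))
    (hσ' : IsFrame (baseChange f (M.inverseImage j)) (oneTmul f σt')) :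
    ∃! b : (B.sec U)ˣ, oneTmul f σt = (b : B.sec U) • oneTmul f σt' := by
  have isBasis {σ : (M.inverseImage j).sec U}
      (hσ : IsFrame (baseChange f (M.inverseImage j)) (oneTmul f σ)) :
      IsBasis (baseChange f (M.inverseImage j)) (oneTmul f σ) :=
    (isBasis_of_induced_by_isBasis ((isFrame_of_isFrame_oneTmul (hM.inverseImage j) hf
      hσ).exists_isBasis_inducing hj hM hA)).oneTmul f
  exact (isBasis hσ).isFreeGenerator.existsUnique_unit (isBasis hσ').isFreeGenerator

include hM in
theorem existsUnique_induced_connection (nab : Connection M) {ι : Type*} {U : ι → Opens Y}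
    (hU : ⨆ i, U i = ⊤) {σt : ∀ i, (M.inverseImage j).sec (U i)}
    {αt : ∀ i, (kaehler (A.inverseImage j)).sec (U i)}
    (hσ : ∀ i, IsFrame (baseChange f (M.inverseImage j)) (oneTmul f (σt i)))
    (h : ∀ i, nab.IsFormAlong (σt i) (αt i)) :
    ∃! nabla : Connection (baseChange f (M.inverseImage j)), ∀ i,
      nabla.app (U i) (oneTmul f (σt i)) =
        theta (kaehler B) (baseChange f (M.inverseImage j)) (U i)
          (conormal f (U i) (oneTmul f (αt i)) ⊗ₜ oneTmul f (σt i)) := by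
  obtain ⟨nabla, hnabla⟩ := nab.exists_induced hM f
  refine ⟨nabla, fun i => hnabla (U i) _ _ (h i), fun nabla' hnabla' => ?_⟩
  refine Connection.ext_of_isFrame ((hM.inverseImage j).baseChange f) fun y => ?_
  obtain ⟨i, hy⟩ := Opens.mem_iSup.mp (hU ▸ Opens.mem_top y)
  exact ⟨U i, hy, oneTmul f (σt i), hσ i,
    (hnabla' i).trans (hnabla (U i) _ _ (h i)).symm⟩

end InducedConnection

/-! ### Smooth functions on projective space -/

section ProjectiveSpace

variable {N : ℕ}

theorem continuous_proj : Continuous (proj (N := N)) := continuous_coinduced_rng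

theorem proj_surjective : Function.Surjective (proj (N := N)) := fun x =>
  ⟨⟨x.rep, x.rep_nonzero⟩, x.mk_rep⟩

theorem proj_eq_proj_iff {v w : punctured N} : proj w = proj v ↔ ∃ c : ℂ, w.1 = c • v.1 :=
  (Projectivization.mk_eq_mk_iff' ℂ w.1 v.1 w.2 v.2).trans (exists_congr fun _ => eq_comm)

theorem eventually_coneNhds {x : PN N} {p : punctured N → Prop} :
    (∀ᶠ v in coneNhds x, p v) ↔ ∃ W : Opens (PN N), x ∈ W ∧ ∀ v, proj v ∈ W → p v := by
  refine ((nhds_basis_opens x).comap proj).eventually_iff.trans ⟨?_, ?_⟩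
  · rintro ⟨W, ⟨hx, hW⟩, h⟩
    exact ⟨⟨W, hW⟩, hx, fun _ hv => h hv⟩
  · rintro ⟨W, hx, h⟩
    exact ⟨W, ⟨hx, W.isOpen⟩, fun v hv => h v hv⟩

theorem contMDiffAt_inv {F : punctured N → ℂ} {v : punctured N}
    (hF : ContMDiffAt 𝓘(ℝ, Fin (N + 1) → ℂ) 𝓘(ℝ, ℂ) ∞ F v) (hv : F v ≠ 0) :
    ContMDiffAt 𝓘(ℝ, Fin (N + 1) → ℂ) 𝓘(ℝ, ℂ) ∞ (fun w => (F w)⁻¹) v :=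
  ContDiffAt.comp_contMDiffAt (g := fun z : ℂ => z⁻¹) (contDiffAt_inv ℝ hv) hF

theorem IsSmoothAt.congr {f g : PN N → ℂ} {x : PN N} (hf : IsSmoothAt f x) (h : g =ᶠ[𝓝 x] f) :
    IsSmoothAt g x := by
  rintro v rfl
  exact (hf v rfl).congr_of_eventuallyEq (continuous_proj.continuousAt.eventually h)

theorem IsSmoothAt.inv {f : PN N → ℂ} {x : PN N} (hf : IsSmoothAt f x) (hx : f x ≠ 0) :
    IsSmoothAt (fun y => (f y)⁻¹) x := by
  rintro v rfl
  exact contMDiffAt_inv (hf v rfl) hx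

theorem continuousOn_of_isSmoothAt {f : PN N → ℂ} {W : Opens (PN N)}
    (hf : ∀ x ∈ W, IsSmoothAt f x) : ContinuousOn f W := by
  refine (continuousOn_open_iff W.isOpen).mpr fun T hT => isOpen_coinduced.mpr ?_
  have continuousOn_comp : ContinuousOn (fun v => f (proj v)) (proj ⁻¹' (W : Set (PN N))) :=
    fun v hv => (hf (proj v) hv v rfl).continuousAt.continuousWithinAt
  exact continuousOn_comp.isOpen_inter_preimage (W.isOpen.preimage continuous_proj) hT

/-- The section of `𝒜_ℙ` defined by a function that is smooth on `W`. -/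
def smoothSection (W : Opens (PN N)) (f : PN N → ℂ) (hf : ∀ x ∈ W, IsSmoothAt f x) :
    (smoothSheafPN N).sec W :=
  ⟨fun x => ⟨f, f, rfl, mem_of_superset (W.isOpen.mem_nhds x.2) hf⟩, f, fun _ => rfl⟩

theorem isSmoothAt_of_coe_mem {f : PN N → ℂ} {x : PN N}
    (h : (f : Germ (𝓝 x) ℂ) ∈ smoothGerms x) : IsSmoothAt f x := by
  obtain ⟨g, e, hg⟩ := h
  exact hg.self_of_nhds.congr (Germ.coe_eq.mp e)

theorem exists_eq_smoothSection {W : Opens (PN N)} (a : (smoothSheafPN N).sec W) :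
    ∃ (f : PN N → ℂ) (hf : ∀ x ∈ W, IsSmoothAt f x), a = smoothSection W f hf := by
  obtain ⟨a, f, hf⟩ := a
  refine ⟨f, fun x hx => isSmoothAt_of_coe_mem ?_, Subtype.ext (funext fun x => Subtype.ext (hf x))⟩
  exact hf ⟨x, hx⟩ ▸ (a ⟨x, hx⟩).2

theorem exists_smoothSection_germ_eq {x : PN N} (a : (smoothSheafPN N).Stalk x) :
    ∃ (W : Opens (PN N)) (hx : x ∈ W) (f : PN N → ℂ) (hf : ∀ x ∈ W, IsSmoothAt f x),
      (smoothSection W f hf).1 ⟨x, hx⟩ = a := by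
  obtain ⟨_, f, rfl, hf⟩ := a
  obtain ⟨W, h, hW, hx⟩ := eventually_nhds_iff.mp hf
  exact ⟨⟨W, hW⟩, hx, f, h, rfl⟩

theorem isUnit_smoothSection {W : Opens (PN N)} {f : PN N → ℂ} (hf : ∀ x ∈ W, IsSmoothAt f x)
    (h0 : ∀ x ∈ W, f x ≠ 0) : IsUnit (smoothSection W f hf) := by
  refine IsUnit.of_mul_eq_one (smoothSection W _ fun x hx => (hf x hx).inv (h0 x hx))
    (Subtype.ext (funext fun x => Subtype.ext (Germ.coe_eq.mpr ?_)))
  filter_upwards [W.isOpen.mem_nhds x.2] with y hy using mul_inv_cancel₀ (h0 y hy)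

theorem exists_isUnit_res_smoothSection {W : Opens (PN N)} {f : PN N → ℂ}
    (hf : ∀ x ∈ W, IsSmoothAt f x) {x : PN N} (hx : x ∈ W) (h0 : f x ≠ 0) :
    ∃ (V : Opens (PN N)) (h : V ≤ W), x ∈ V ∧
      IsUnit ((smoothSheafPN N).res h (smoothSection W f hf)) :=
  ⟨⟨W ∩ f ⁻¹' {0}ᶜ, (continuousOn_of_isSmoothAt hf).isOpen_inter_preimage W.isOpen
    isOpen_compl_singleton⟩, Set.inter_subset_left, ⟨hx, h0⟩,
    isUnit_smoothSection (fun y hy => hf y (Set.inter_subset_left hy)) fun _ hy => hy.2⟩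

theorem hasOpenUnits_smoothSheafPN : (smoothSheafPN N).HasOpenUnits := fun U a x ha => by
  obtain ⟨f, hf, rfl⟩ := exists_eq_smoothSection a
  have value_ne_zero : f x ≠ 0 :=
    ((ha.map (Subalgebra.val _)).map Germ.valueRingHom).ne_zero
  exact exists_isUnit_res_smoothSection hf x.2 value_ne_zero

theorem isLocalHom_restrictionHom (Y : Set (PN N)) (y : Y) :
    IsLocalHom ((restrictionHom Y).stalk y) := ⟨fun a ha => by
  obtain ⟨W, hx, f, hf, rfl⟩ := exists_smoothSection_germ_eq a
  have value_ne_zero : f y ≠ 0 :=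
    ((ha.map (Subalgebra.val _)).map Germ.valueRingHom).ne_zero
  obtain ⟨V, h, hxV, hV⟩ := exists_isUnit_res_smoothSection hf hx value_ne_zero
  exact hV.map ((Pi.evalRingHom _ (⟨incl Y y, hxV⟩ : V)).comp
    ((smoothSheafPN N).sec V).val.toRingHom)⟩

/-! ### The hyperplane bundle -/

/-- `F` is smooth and homogeneous of degree one at `v`; the germs of such functions are the germs
of sections of `𝒪(1)`. -/
def IsSmoothHomogeneousAt (F : punctured N → ℂ) (v : punctured N) : Prop :=
  ContMDiffAt 𝓘(ℝ, Fin (N + 1) → ℂ) 𝓘(ℝ, ℂ) ∞ F v ∧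
    ∀ (c : ℂ) (w : punctured N), w.1 = c • v.1 → F w = c * F v

theorem IsSmoothHomogeneousAt.congr {F G : punctured N → ℂ} {W : Opens (PN N)} {v : punctured N}
    (hF : IsSmoothHomogeneousAt F v) (hv : proj v ∈ W) (h : ∀ w, proj w ∈ W → G w = F w) :
    IsSmoothHomogeneousAt G v := by
  refine ⟨hF.1.congr_of_eventuallyEq ?_, fun c w hw => ?_⟩
  · filter_upwards [(W.isOpen.preimage continuous_proj).mem_nhds hv] using h
  · rw [h v hv, h w ((proj_eq_proj_iff.mpr ⟨c, hw⟩).symm ▸ hv), hF.2 c w hw]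

theorem isSmoothHomogeneousAt_of_coe_mem {F : punctured N → ℂ} {v : punctured N}
    (h : (F : Germ (coneNhds (proj v)) ℂ) ∈ sectionGerms (proj v)) :
    IsSmoothHomogeneousAt F v := by
  obtain ⟨G, e, hG⟩ := h
  obtain ⟨W, hv, hW⟩ := eventually_coneNhds.mp ((Germ.coe_eq.mp e).and hG)
  exact IsSmoothHomogeneousAt.congr (hW v hv).2 hv fun w hw => (hW w hw).1

theorem IsSmoothHomogeneousAt.div_eq_div {F G : punctured N → ℂ} {v w : punctured N}
    (hF : IsSmoothHomogeneousAt F v) (hG : IsSmoothHomogeneousAt G v) (h : proj w = proj v) :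
    G w * (F w)⁻¹ = G v * (F v)⁻¹ := by
  obtain ⟨c, hc⟩ := proj_eq_proj_iff.mp h
  have c_ne_zero : c ≠ 0 := fun h0 => w.2 (by rw [hc, h0, zero_smul])
  rw [hF.2 c w hc, hG.2 c w hc, ← div_eq_mul_inv, ← div_eq_mul_inv,
    mul_div_mul_left _ _ c_ne_zero]

/-- The section of `𝒪(1)` over `W` defined by a smooth homogeneous function on the cone. -/
def homogeneousSection (W : Opens (PN N)) (F : punctured N → ℂ)
    (hF : ∀ v, proj v ∈ W → IsSmoothHomogeneousAt F v) : (O1 N).sec W :=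
  ⟨fun x => ⟨F, F, rfl, eventually_coneNhds.mpr ⟨W, x.2, hF⟩⟩, F, fun _ => rfl⟩

theorem exists_eq_homogeneousSection {W : Opens (PN N)} (s : (O1 N).sec W) :
    ∃ (F : punctured N → ℂ) (hF : ∀ v, proj v ∈ W → IsSmoothHomogeneousAt F v),
      s = homogeneousSection W F hF := by
  obtain ⟨s, F, hF⟩ := s
  refine ⟨F, fun v hv => isSmoothHomogeneousAt_of_coe_mem ?_,
    Subtype.ext (funext fun x => Subtype.ext (hF x))⟩
  exact hF ⟨proj v, hv⟩ ▸ (s ⟨proj v, hv⟩).2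

theorem exists_homogeneousSection_germ_eq {x : PN N} (m : (O1 N).Stalk x) :
    ∃ (W : Opens (PN N)) (hx : x ∈ W) (F : punctured N → ℂ)
      (hF : ∀ v, proj v ∈ W → IsSmoothHomogeneousAt F v),
      (homogeneousSection W F hF).1 ⟨x, hx⟩ = m := by
  obtain ⟨_, F, rfl, hF⟩ := m
  obtain ⟨W, hx, hW⟩ := eventually_coneNhds.mp hF
  exact ⟨W, hx, F, hW, rfl⟩

theorem exists_smul_homogeneousSection_eq {W : Opens (PN N)} {F G : punctured N → ℂ}
    (hF : ∀ v, proj v ∈ W → IsSmoothHomogeneousAt F v)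
    (hG : ∀ v, proj v ∈ W → IsSmoothHomogeneousAt G v) (h0 : ∀ v, proj v ∈ W → F v ≠ 0) :
    ∃ a : (smoothSheafPN N).sec W, ∀ x : W,
      a.1 x • (homogeneousSection W F hF).1 x = (homogeneousSection W G hG).1 x := by
  choose r hr using proj_surjective (N := N)
  have quotient_eq (v : punctured N) (hv : proj v ∈ W) :
      G (r (proj v)) * (F (r (proj v)))⁻¹ = G v * (F v)⁻¹ :=
    (hF v hv).div_eq_div (hG v hv) (hr (proj v))
  refine ⟨smoothSection W (fun x => G (r x) * (F (r x))⁻¹) ?_, fun x => Subtype.ext ?_⟩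
  · rintro x hx v rfl
    refine (contMDiffAt_mul (hG v hx).1 (contMDiffAt_inv (hF v hx).1
      (h0 v hx))).congr_of_eventuallyEq ?_
    filter_upwards [(W.isOpen.preimage continuous_proj).mem_nhds hx] using quotient_eq
  · refine Germ.coe_eq.mpr (eventually_coneNhds.mpr ⟨W, x.2, fun v hv => ?_⟩)
    change G (r (proj v)) * (F (r (proj v)))⁻¹ * F v = G v
    rw [quotient_eq v hv, inv_mul_cancel_right₀ (h0 v hv)]

theorem smul_homogeneousSection_injective {W : Opens (PN N)} {F : punctured N → ℂ}
    (hF : ∀ v, proj v ∈ W → IsSmoothHomogeneousAt F v) (h0 : ∀ v, proj v ∈ W → F v ≠ 0) (x : W) :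
    Function.Injective fun a : (smoothSheafPN N).Stalk x =>
      a • (homogeneousSection W F hF).1 x := by
  rintro ⟨_, f, rfl, hf⟩ ⟨_, g, rfl, hg⟩ h
  have mul_eq : ((fun v => f (proj v) * F v : punctured N → ℂ) : Germ (coneNhds x.1) ℂ) =
      (fun v => g (proj v) * F v : punctured N → ℂ) := congrArg Subtype.val h
  obtain ⟨V, hx, hV⟩ := eventually_coneNhds.mp (Germ.coe_eq.mp mul_eq)
  refine Subtype.ext (Germ.coe_eq.mpr ?_)
  filter_upwards [V.isOpen.mem_nhds hx, W.isOpen.mem_nhds x.2] with y hyV hyW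
  obtain ⟨v, rfl⟩ := proj_surjective y
  exact mul_right_cancel₀ (h0 v hyW) (hV v hyV)

theorem isBasis_homogeneousSection {W : Opens (PN N)} {F : punctured N → ℂ}
    (hF : ∀ v, proj v ∈ W → IsSmoothHomogeneousAt F v) (h0 : ∀ v, proj v ∈ W → F v ≠ 0) :
    IsBasis (O1 N) (homogeneousSection W F hF) where
  isFrame x := by
    refine ⟨smul_homogeneousSection_injective hF h0 x, fun m => ?_⟩
    obtain ⟨V, hx, G, hG, rfl⟩ := exists_homogeneousSection_germ_eq m
    obtain ⟨a, ha⟩ := exists_smul_homogeneousSection_eq (W := W ⊓ V) (fun v hv => hF v hv.1)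
      (fun v hv => hG v hv.2) fun v hv => h0 v hv.1
    exact ⟨a.1 ⟨x.1, x.2, hx⟩, ha ⟨x.1, x.2, hx⟩⟩
  exists_coeff h s := by
    obtain ⟨G, hG, rfl⟩ := exists_eq_homogeneousSection s
    exact exists_smul_homogeneousSection_eq (fun v hv => hF v (h hv)) hG fun v hv => h0 v (h hv)

theorem proj_mem_image_coord {i : Fin (N + 1)} {v : punctured N} :
    proj v ∈ proj '' {w : punctured N | w.1 i ≠ 0} ↔ v.1 i ≠ 0 := by
  refine ⟨?_, fun hv => ⟨v, hv, rfl⟩⟩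
  rintro ⟨w, hw, e⟩ hv
  obtain ⟨c, hc⟩ := proj_eq_proj_iff.mp e
  exact hw (by rw [hc, Pi.smul_apply, hv, smul_zero])

/-- The affine chart `{z_i ≠ 0}` of `ℙ^N`, over which the coordinate `z_i` trivializes `𝒪(1)`. -/
def affineChart (i : Fin (N + 1)) : Opens (PN N) where
  carrier := proj '' {v : punctured N | v.1 i ≠ 0}
  is_open' := by
    have preimage_eq : proj ⁻¹' (proj '' {v : punctured N | v.1 i ≠ 0}) = {v | v.1 i ≠ 0} :=
      Set.ext fun _ => proj_mem_image_coord
    have continuous_coord : Continuous fun v : punctured N => v.1 i :=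
      (continuous_apply i).comp continuous_subtype_val
    rw [isOpen_coinduced, preimage_eq]
    exact isOpen_ne_fun continuous_coord continuous_const

theorem exists_mem_affineChart (x : PN N) : ∃ i, x ∈ affineChart i := by
  obtain ⟨v, rfl⟩ := proj_surjective x
  obtain ⟨i, hi⟩ := Function.ne_iff.mp v.2
  exact ⟨i, v, hi, rfl⟩

theorem isSmoothHomogeneousAt_coord (i : Fin (N + 1)) (v : punctured N) :
    IsSmoothHomogeneousAt (fun w => w.1 i) v :=
  ⟨ContDiffAt.comp_contMDiffAt (g := fun z : Fin (N + 1) → ℂ => z i)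
    (contDiff_apply ℝ ℂ i).contDiffAt (contMDiff_subtype_val v), fun _ _ hw => congrFun hw i⟩

theorem isLineBundle_O1 : IsLineBundle (O1 N) := fun x => by
  obtain ⟨i, hx⟩ := exists_mem_affineChart x
  exact ⟨affineChart i, hx, _, isBasis_homogeneousSection
    (fun v _ => isSmoothHomogeneousAt_coord i v) fun _ => proj_mem_image_coord.mp⟩

end ProjectiveSpace

end GermSheaf

end

theorem proposition5p1_general {X Y : Type} [TopologicalSpace X] [TopologicalSpace Y]
    {A : AlgSheaf X} (hA : A.HasOpenUnits) {M : ModSheaf A} (hM : IsLineBundle M)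
    {j : C(Y, X)} (hj : IsInducing j) {B : AlgSheaf Y} (f : (A.inverseImage j).Hom B)
    (hf : ∀ y, IsLocalHom (f.stalk y)) (nab : Connection M) :
    (∀ (U : Opens Y) (σt : (M.inverseImage j).sec U),
      IsFrame (baseChange f (M.inverseImage j)) (oneTmul f σt) →
        ∃! αt : (kaehler (A.inverseImage j)).sec U, nab.IsFormAlong σt αt) ∧
    (∀ (U : Opens Y) (σt σt' : (M.inverseImage j).sec U)
      (αt αt' : (kaehler (A.inverseImage j)).sec U),
      IsFrame (baseChange f (M.inverseImage j)) (oneTmul f σt) →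
      IsFrame (baseChange f (M.inverseImage j)) (oneTmul f σt') →
      nab.IsFormAlong σt αt → nab.IsFormAlong σt' αt' →
        (∃! b : (B.sec U)ˣ, oneTmul f σt = (b : B.sec U) • oneTmul f σt') ∧
        ∀ b : (B.sec U)ˣ, oneTmul f σt = (b : B.sec U) • oneTmul f σt' →
          conormal f U (oneTmul f αt) = conormal f U (oneTmul f αt') +
            ((b⁻¹ : (B.sec U)ˣ) : B.sec U) • dif (b : B.sec U)) ∧
    (∀ (ι : Type*) (U : ι → Opens Y) (_ : ⨆ i, U i = ⊤)
      (σt : ∀ i, (M.inverseImage j).sec (U i))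
      (αt : ∀ i, (kaehler (A.inverseImage j)).sec (U i)),
      (∀ i, IsFrame (baseChange f (M.inverseImage j)) (oneTmul f (σt i))) →
      (∀ i, nab.IsFormAlong (σt i) (αt i)) →
        ∃! nabla : Connection (baseChange f (M.inverseImage j)), ∀ i,
          nabla.app (U i) (oneTmul f (σt i)) =
            theta (kaehler B) (baseChange f (M.inverseImage j)) (U i)
              (conormal f (U i) (oneTmul f (αt i)) ⊗ₜ oneTmul f (σt i))) :=
  ⟨fun _ _ hσ => (isFrame_of_isFrame_oneTmul (hM.inverseImage j) hf hσ).existsUnique_isFormAlong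
      hj hM hA nab,
    fun _ _ _ _ _ hσ hσ' h h' => ⟨existsUnique_unit_oneTmul hj hM hA f hf hσ hσ',
      h.gauge hM f h' hσ'⟩,
    fun _ _ hU _ _ hσ h => existsUnique_induced_connection hM f nab hU hσ h⟩

theorem proposition5p1 {N : ℕ} (Y : Set (PN N)) (nablat : Connection (O1 N)) :
    (∀ (U : Opens Y) (σt : ((O1 N).inverseImage (incl Y)).sec U),
      IsFrame (bundleL Y) (inducedSection σt) →
        ∃! αt : (kaehler (sheafR Y)).sec U, IsConnectionForm nablat σt αt) ∧
    (∀ (U : Opens Y) (σt σt' : ((O1 N).inverseImage (incl Y)).sec U)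
      (αt αt' : (kaehler (sheafR Y)).sec U),
      IsFrame (bundleL Y) (inducedSection σt) → IsFrame (bundleL Y) (inducedSection σt') →
      IsConnectionForm nablat σt αt → IsConnectionForm nablat σt' αt' →
        (∃! b : ((smoothSheafOn Y).sec U)ˣ,
          inducedSection σt = (b : (smoothSheafOn Y).sec U) • inducedSection σt') ∧
        ∀ b : ((smoothSheafOn Y).sec U)ˣ,
          inducedSection σt = (b : (smoothSheafOn Y).sec U) • inducedSection σt' →
            inducedForm αt = inducedForm αt' +
              ((b⁻¹ : ((smoothSheafOn Y).sec U)ˣ) : (smoothSheafOn Y).sec U) •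
                dif (b : (smoothSheafOn Y).sec U)) ∧
    (∀ (ι : Type*) (U : ι → Opens Y) (_ : ⨆ i, U i = ⊤)
      (σt : ∀ i, ((O1 N).inverseImage (incl Y)).sec (U i))
      (αt : ∀ i, (kaehler (sheafR Y)).sec (U i)),
      (∀ i, IsFrame (bundleL Y) (inducedSection (σt i))) →
      (∀ i, IsConnectionForm nablat (σt i) (αt i)) →
        ∃! nabla : Connection (bundleL Y), ∀ i,
          nabla.app (U i) (inducedSection (σt i)) =
            theta (kaehler (smoothSheafOn Y)) (bundleL Y) (U i)
              (inducedForm (αt i) ⊗ₜ inducedSection (σt i))) :=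
  proposition5p1_general hasOpenUnits_smoothSheafPN isLineBundle_O1 IsInducing.subtypeVal
    (restrictionHom Y) (isLocalHom_restrictionHom Y) nablat
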